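/- Let $\Gamma$ be a group or, more generally, a monoid with unit $e$. All schemes below are schemes over $\mathbb F_2$. **The scheme $\mathrm{Rep}_2(\Gamma)_{u/\mathbb F_2}$.** Let $\mathrm{Rep}_2(\Gamma)_{\mathbb F_2}$ be the affine $\mathbb F_2$-scheme of representations $\rho:\Gamma\to M_2(\mathcal O)$. Consider its closed subscheme where $\operatorname{tr}\rho(\gamma)=0$ for all $\gamma\in\Gamma$ and where, for all $\alpha,\beta,\gamma\in\Gamma$, every $3\times 3$ minor of the $4\times 3$ matrix whose columns are the entries of $\rho(\alpha),\rho(\beta),\rho(\gamma)$ vanishes. Then $\mathrm{Rep}_2(\Gamma)_{u/\mathbb F_2}$ is the open subscheme of it where $\rho(\Gamma)$ generates an algebra of rank $2$, that is, the set of points $x$ such that the image of $\rho(\Gamma)$ in $M_2(\kappa(x))$ generates a $2$-dimensional $\kappa(x)$-algebra. For $\alpha\in\Gamma$, let $\mathrm{Rep}_2(\Gamma)_{u/\mathbb F_2,\alpha}$ be the open subscheme where $\rho(\alpha)$ alone generates a $2$-dimensional algebra. These open subschemes cover $\mathrm{Rep}_2(\Gamma)_{u/\mathbb F_2}$. **The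 scheme $\mathrm{Ch}_2(\Gamma)_{u/\mathbb F_2}$.** For $\alpha\in\Gamma$, let $\mathrm{Ch}_2(\Gamma)_{u/\mathbb F_2,\alpha}$ be the affine scheme over $\mathbb F_2$ whose $R$-points are the triples $(d,a,b)$ in which $d:\Gamma\to R$ is a multiplicative unital map and $a,b:\Gamma\to R$ are functions with $a(e)=1$, $b(e)=0$, $a(\alpha)=0$, $b(\alpha)=1$ and, for all $\gamma,\delta\in\Gamma$, $$a(\gamma\delta)=a(\gamma)a(\delta)+b(\gamma)b(\delta)d(\alpha),\quad b(\gamma\delta)=a(\gamma)b(\delta)+b(\gamma)a(\delta),\quad a(\gamma)^2+b(\gamma)^2d(\alpha)=d(\gamma).$$ Let $U_{\alpha,\beta}\subseteq \mathrm{Ch}_2(\Gamma)_{u/\mathbb F_2,\alpha}$ be the open subscheme where $b(\beta)$ is invertible. The schemes $\mathrm{Ch}_2(\Gamma)_{u/\mathbb F_2,\alpha}$, $\alpha\in\Gamma$, are glued to a scheme $\mathrm{Ch}_2(\Gamma)_{u/\mathbb F_2}$ along the isomorphisms $U_{\alpha,\beta}\cong U_{\beta,\alpha}$ that send $(d,a,b)$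 to $(d,a',b')$ with $a'(\gamma)=a(\gamma)+a(\beta)b(\beta)^{-1}b(\gamma)$ and $b'(\gamma)=b(\beta)^{-1}b(\gamma)$. **The morphism $\pi$.** On $\mathrm{Rep}_2(\Gamma)_{u/\mathbb F_2,\alpha}$ there are unique functions $a(\gamma),b(\gamma)$ with $\rho(\gamma)=a(\gamma)I_2+b(\gamma)\rho(\alpha)$ for all $\gamma\in\Gamma$. Together with $d=\det\rho$ they define a morphism $\pi_\alpha:\mathrm{Rep}_2(\Gamma)_{u/\mathbb F_2,\alpha}\to\mathrm{Ch}_2(\Gamma)_{u/\mathbb F_2,\alpha}$, and the $\pi_\alpha$ glue to a morphism $\pi=\pi_{\Gamma,u/\mathbb F_2}:\mathrm{Rep}_2(\Gamma)_{u/\mathbb F_2}\to\mathrm{Ch}_2(\Gamma)_{u/\mathbb F_2}$. **The action.** $\mathrm{PGL}_2\otimes\mathbb F_2$ is the affine group scheme over $\mathbb F_2$ representing $T\mapsto\mathrm{Aut}_{\mathcal O_T\text{-alg}}(M_2(\mathcal O_T))$. It acts from the right on $\mathrm{Rep}_2(\Gamma)_{u/\mathbb F_2}$ by $\rho\cdot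 g=g^{-1}\circ\rho$, so that $\rho\cdot P=P^{-1}\rho P$ if $g$ is the conjugation $X\mapsto PXP^{-1}$. **Geometric quotients.** Let a group scheme $G$ over a scheme $S$ act on an $S$-scheme $X$ through $\sigma:X\times_SG\to X$, and let $p_1:X\times_SG\to X$ be the projection. A morphism $\pi:X\to Y$ of $S$-schemes is a *geometric quotient* of $X$ by $G$ if (i) $\pi\circ\sigma=\pi\circ p_1$; (ii) $\pi$ is surjective and the image of $(\sigma,p_1):X\times_SG\to X\times_SX$ is $X\times_YX$; (iii) a subset $U\subseteq Y$ is open if and only if $\pi^{-1}(U)$ is open; (iv) for every open $U\subseteq Y$, the map $\mathcal O_Y(U)\to\mathcal O_X(\pi^{-1}(U))$ is injective with image the functions $f$ such that $\sigma^*f=p_1^*f$. It is a *universal geometric quotient* if $X\times_YY'\to Y'$ is a geometric quotient of $X\times_YY'$ by $G$ (with the action induced by base change) for every morphism $Y'\to Y$. **Corollary.** For every group or monoid $\Gamma$, the morphism $\pi_{\Gamma,u/\mathbb F_2}:\mathrm{Rep}_2(\Gamma)_{u/\mathbb F_2}\to\mathrm{Ch}_2(\Gamma)_{u/\mathbb F_2}$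 is a universal geometric quotient by $\mathrm{PGL}_2\otimes\mathbb F_2$. -/

import Mathlib

open CategoryTheory Limits MonoidalCategory CartesianMonoidalCategory AlgebraicGeometry

universe u v w

noncomputable section

namespace UnipotentMold

section Coordinates

/-- The field `𝔽₂`, placed in the universe `u`. -/
abbrev F2 : Type u := ULift.{u} (ZMod 2)

theorem F2.subsingleton_hom {R : Type v} [CommRing R] (f g : F2.{u} →+* R) : f = g := by
  have h : f.comp (ULift.ringEquiv (R := ZMod 2)).symm.toRingHom =
      g.comp (ULift.ringEquiv (R := ZMod 2)).symm.toRingHom := Subsingleton.elim _ _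
  ext x
  exact congrArg (fun k : ZMod 2 →+* R => k x.down) h

theorem F2.two_eq_zero {R : Type v} [CommRing R] (c : F2.{u} →+* R) : (2 : R) = 0 := by
  have h : (2 : F2.{u}) = 0 := by
    apply ULift.ext
    exact (by decide : (2 : ZMod 2) = 0)
  have := congrArg c h
  rw [map_ofNat, map_zero] at this
  exact this

section Rings

variable (Γ : Type u) [Monoid Γ]

/-! ### The coordinate rings of the representation varieties over `𝔽₂` -/

/-- The matrix of indeterminates attached to `γ`. -/
def genericMatrix (n : ℕ) (γ : Γ) :
    Matrix (Fin n) (Fin n) (MvPolynomial (Γ × Fin n × Fin n) F2.{u}) :=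
  Matrix.of fun i j => MvPolynomial.X (γ, i, j)

/-- The entries of `X_e - 1` and of `X_{γδ} - X_γ X_δ`. -/
def repRelations (n : ℕ) : Set (MvPolynomial (Γ × Fin n × Fin n) F2.{u}) :=
  {p | ∃ i j, p = (genericMatrix Γ n 1 - 1) i j} ∪
  {p | ∃ γ δ i j, p = (genericMatrix Γ n (γ * δ) - genericMatrix Γ n γ * genericMatrix Γ n δ) i j}

/-- The coordinate ring of `Rep_n(Γ) ⊗ 𝔽₂`, the affine scheme of `n`-dimensional representations
of `Γ` over `𝔽₂`-schemes. -/
def RepRing (n : ℕ) : Type u :=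
  MvPolynomial (Γ × Fin n × Fin n) F2.{u} ⧸ Ideal.span (repRelations Γ n)

instance (n : ℕ) : CommRing (RepRing Γ n) :=
  inferInstanceAs (CommRing (MvPolynomial (Γ × Fin n × Fin n) F2.{u} ⧸
    Ideal.span (repRelations Γ n)))

def RepRing.mk (n : ℕ) : MvPolynomial (Γ × Fin n × Fin n) F2.{u} →+* RepRing Γ n :=
  Ideal.Quotient.mk _

/-- The structure map `𝔽₂ → A_n(Γ)`. -/
def RepRing.base (n : ℕ) : F2.{u} →+* RepRing Γ n :=
  (RepRing.mk Γ n).comp MvPolynomial.C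

/-- The universal representation of degree `n`. -/
def universalRep (n : ℕ) : Γ →* Matrix (Fin n) (Fin n) (RepRing Γ n) where
  toFun γ := (genericMatrix Γ n γ).map (RepRing.mk Γ n)
  map_one' := by
    rw [← sub_eq_zero]
    ext i j
    have h : RepRing.mk Γ n ((genericMatrix Γ n 1 - 1) i j) = 0 :=
      Ideal.Quotient.eq_zero_iff_mem.2 (Ideal.subset_span (Or.inl ⟨i, j, rfl⟩))
    simpa [Matrix.one_apply, apply_ite (RepRing.mk Γ n)] using h
  map_mul' γ δ := by
    rw [← sub_eq_zero]
    ext i j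
    have h : RepRing.mk Γ n ((genericMatrix Γ n (γ * δ) -
        genericMatrix Γ n γ * genericMatrix Γ n δ) i j) = 0 :=
      Ideal.Quotient.eq_zero_iff_mem.2 (Ideal.subset_span (Or.inr ⟨γ, δ, i, j, rfl⟩))
    simpa [Matrix.mul_apply] using h

variable {Γ}

theorem RepRing.hom_ext {n : ℕ} {R : Type v} [CommRing R] {f g : RepRing Γ n →+* R}
    (h : ∀ γ i j, f (universalRep Γ n γ i j) = g (universalRep Γ n γ i j)) : f = g := by
  apply Ideal.Quotient.ringHom_ext
  apply MvPolynomial.ringHom_ext'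
  · exact F2.subsingleton_hom _ _
  · rintro ⟨γ, i, j⟩
    exact h γ i j

/-- The homomorphism out of `A_n(Γ)` that classifies a representation. -/
def RepRing.lift {n : ℕ} {R : Type v} [CommRing R] (c : F2.{u} →+* R)
    (ρ : Γ →* Matrix (Fin n) (Fin n) R) : RepRing Γ n →+* R :=
  Ideal.Quotient.lift _ (MvPolynomial.eval₂Hom c fun x => ρ x.1 x.2.1 x.2.2) (by
    intro p hp
    rw [← RingHom.mem_ker]
    refine (Ideal.span_le (I := RingHom.ker _)).2 ?_ hp
    rintro p (⟨i, j, rfl⟩ | ⟨γ, δ, i, j, rfl⟩)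
    · simp [genericMatrix, RingHom.mem_ker, Matrix.one_apply,
        apply_ite (MvPolynomial.eval₂ c _)]
    · simp [genericMatrix, RingHom.mem_ker, Matrix.mul_apply])

@[simp] theorem RepRing.lift_universalRep {n : ℕ} {R : Type v} [CommRing R] (c : F2.{u} →+* R)
    (ρ : Γ →* Matrix (Fin n) (Fin n) R) (γ : Γ) (i j : Fin n) :
    RepRing.lift c ρ (universalRep Γ n γ i j) = ρ γ i j := by
  change MvPolynomial.eval₂Hom c (fun x : Γ × Fin n × Fin n => ρ x.1 x.2.1 x.2.2)
    (MvPolynomial.X (γ, i, j)) = _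
  simp

/-! ### Trace zero representations of rank at most two -/

variable (Γ) in
/-- Representations `ρ : Γ → M₂(R)` such that `tr ρ(γ) = 0` for all `γ` and such that all
`3 × 3` minors of the `4 × 3` matrices with columns `ρ(α)`, `ρ(β)`, `ρ(γ)` vanish. -/
structure TraceZeroRep (R : Type v) [CommRing R] where
  rep : Γ →* Matrix (Fin 2) (Fin 2) R
  trace_eq_zero : ∀ γ, (rep γ).trace = 0
  minor_eq_zero : ∀ (g : Fin 3 → Γ) (r : Fin 3 → Fin 2 × Fin 2),
    (Matrix.of fun i j => rep (g j) (r i).1 (r i).2).det = 0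

variable (Γ) in
/-- The equations in `A_2(Γ)_{𝔽₂}` of the closed subscheme where all `3 × 3` minors and all
traces vanish. -/
def unipRelations : Set (RepRing Γ 2) :=
  {p | ∃ γ, p = (universalRep Γ 2 γ).trace} ∪
  {p | ∃ (g : Fin 3 → Γ) (r : Fin 3 → Fin 2 × Fin 2),
    p = (Matrix.of fun i j => universalRep Γ 2 (g j) (r i).1 (r i).2).det}

variable (Γ) in
/-- The coordinate ring of the closed subscheme of `Rep_2(Γ)_{𝔽₂}` where all `3 × 3` minors and
all traces vanish. -/
def UnipRing : Type u := RepRing Γ 2 ⧸ Ideal.span (unipRelations Γ)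

instance : CommRing (UnipRing Γ) :=
  inferInstanceAs (CommRing (RepRing Γ 2 ⧸ Ideal.span (unipRelations Γ)))

variable (Γ) in
def UnipRing.mk : RepRing Γ 2 →+* UnipRing Γ := Ideal.Quotient.mk _

variable (Γ) in
def UnipRing.base : F2.{u} →+* UnipRing Γ := (UnipRing.mk Γ).comp (RepRing.base Γ 2)

/-- Extension of scalars. -/
def TraceZeroRep.map {R : Type v} [CommRing R] {R' : Type w} [CommRing R']
    (P : TraceZeroRep Γ R) (f : R →+* R') : TraceZeroRep Γ R' where
  rep := (RingHom.mapMatrix f).toMonoidHom.comp P.rep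
  trace_eq_zero γ := by
    have := congrArg f (P.trace_eq_zero γ)
    simpa [Matrix.trace] using this
  minor_eq_zero g r := by
    have := congrArg f (P.minor_eq_zero g r)
    rw [RingHom.map_det, map_zero] at this
    exact this

variable (Γ) in
def UnipRing.universal : TraceZeroRep Γ (UnipRing Γ) where
  rep := (RingHom.mapMatrix (UnipRing.mk Γ)).toMonoidHom.comp (universalRep Γ 2)
  trace_eq_zero γ := by
    have h : UnipRing.mk Γ (universalRep Γ 2 γ).trace = 0 :=
      Ideal.Quotient.eq_zero_iff_mem.2 (Ideal.subset_span (Or.inl ⟨γ, rfl⟩))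
    simpa [Matrix.trace] using h
  minor_eq_zero g r := by
    have h : UnipRing.mk Γ (Matrix.of fun i j => universalRep Γ 2 (g j) (r i).1 (r i).2).det = 0 :=
      Ideal.Quotient.eq_zero_iff_mem.2 (Ideal.subset_span (Or.inr ⟨g, r, rfl⟩))
    rw [RingHom.map_det] at h
    exact h

theorem TraceZeroRep.ext' {R : Type v} [CommRing R] {P Q : TraceZeroRep Γ R}
    (h : ∀ γ, P.rep γ = Q.rep γ) : P = Q := by
  cases P; cases Q
  congr
  exact MonoidHom.ext h

@[simp] theorem TraceZeroRep.map_rep {R : Type v} [CommRing R] {R' : Type w} [CommRing R']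
    (P : TraceZeroRep Γ R) (f : R →+* R') (γ : Γ) : (P.map f).rep γ = (P.rep γ).map f := rfl

theorem UnipRing.hom_ext {R : Type v} [CommRing R] {f g : UnipRing Γ →+* R}
    (h : (UnipRing.universal Γ).map f = (UnipRing.universal Γ).map g) : f = g := by
  apply Ideal.Quotient.ringHom_ext
  apply RepRing.hom_ext
  intro γ i j
  exact congrFun (congrFun (congrArg (fun P => P.rep γ) h) i) j

def UnipRing.lift {R : Type v} [CommRing R] (c : F2.{u} →+* R) (P : TraceZeroRep Γ R) :
    UnipRing Γ →+* R :=
  Ideal.Quotient.lift _ (RepRing.lift c P.rep) (by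
    intro p hp
    rw [← RingHom.mem_ker]
    refine (Ideal.span_le (I := RingHom.ker _)).2 ?_ hp
    rintro p (⟨γ, rfl⟩ | ⟨g, r, rfl⟩)
    · have := P.trace_eq_zero γ
      simpa [RingHom.mem_ker, Matrix.trace] using this
    · have := P.minor_eq_zero g r
      rw [SetLike.mem_coe, RingHom.mem_ker, RingHom.map_det, ← this]
      congr 1
      ext i j
      simp)

@[simp] theorem UnipRing.map_lift {R : Type v} [CommRing R] (c : F2.{u} →+* R)
    (P : TraceZeroRep Γ R) : (UnipRing.universal Γ).map (UnipRing.lift c P) = P := by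
  apply TraceZeroRep.ext'
  intro γ
  ext i j
  exact RepRing.lift_universalRep c P.rep γ i j

/-! ### `(a, b)`-coefficients -/

variable (Γ) in
/-- A character `d` together with `(a, b)`-coefficients with respect to `(d, α)`. -/
@[ext]
structure ABCoeff (R : Type v) [CommRing R] (α : Γ) where
  d : Γ →* R
  a : Γ → R
  b : Γ → R
  a_one : a 1 = 1
  b_one : b 1 = 0
  a_self : a α = 0
  b_self : b α = 1
  a_mul : ∀ γ δ, a (γ * δ) = a γ * a δ + b γ * b δ * d α
  b_mul : ∀ γ δ, b (γ * δ) = a γ * b δ + b γ * a δ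
  norm : ∀ γ, a γ ^ 2 + b γ ^ 2 * d α = d γ

def ABCoeff.map {R : Type v} [CommRing R] {R' : Type w} [CommRing R'] {α : Γ}
    (P : ABCoeff Γ R α) (f : R →+* R') : ABCoeff Γ R' α where
  d := (f : R →* R').comp P.d
  a γ := f (P.a γ)
  b γ := f (P.b γ)
  a_one := by simp [P.a_one]
  b_one := by simp [P.b_one]
  a_self := by simp [P.a_self]
  b_self := by simp [P.b_self]
  a_mul γ δ := by simp [P.a_mul]
  b_mul γ δ := by simp [P.b_mul]
  norm γ := by simp [← P.norm γ]

@[simp] theorem ABCoeff.map_b {R : Type v} [CommRing R] {R' : Type w} [CommRing R'] {α : Γ}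
    (P : ABCoeff Γ R α) (f : R →+* R') (γ : Γ) : (P.map f).b γ = f (P.b γ) := rfl

@[simp] theorem ABCoeff.map_a {R : Type v} [CommRing R] {R' : Type w} [CommRing R'] {α : Γ}
    (P : ABCoeff Γ R α) (f : R →+* R') (γ : Γ) : (P.map f).a γ = f (P.a γ) := rfl

theorem ABCoeff.map_map {R : Type v} [CommRing R] {R' : Type w} [CommRing R']
    {R'' : Type*} [CommRing R''] {α : Γ}
    (P : ABCoeff Γ R α) (f : R →+* R') (g : R' →+* R'') :
    (P.map f).map g = P.map (g.comp f) := rfl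

/-- Two systems with the same `a` and `b` coincide, since `d` is determined by them. -/
theorem ABCoeff.ext_ab {R : Type v} [CommRing R] {α : Γ} {P Q : ABCoeff Γ R α}
    (ha : ∀ γ, P.a γ = Q.a γ) (hb : ∀ γ, P.b γ = Q.b γ) : P = Q := by
  have hd : P.d α = Q.d α := by
    have h1 := P.a_mul α α
    have h2 := Q.a_mul α α
    rw [P.a_self, P.b_self] at h1
    rw [Q.a_self, Q.b_self] at h2
    have := ha (α * α)
    rw [h1, h2] at this
    simpa using this
  apply ABCoeff.ext
  · ext γ
    rw [← P.norm, ← Q.norm, ha, hb, hd]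
  · exact funext ha
  · exact funext hb

/-- The character ring `A_1(Γ)_{𝔽₂}` carries the universal character `d`. -/
def universalChar : Γ →* RepRing Γ 1 where
  toFun γ := universalRep Γ 1 γ 0 0
  map_one' := by simp
  map_mul' γ δ := by simp [Matrix.mul_apply]

open MvPolynomial in
/-- The generators of the ideal `I` of `A_1(Γ)_{𝔽₂}[a(γ), b(γ) | γ ∈ Γ]`; the indeterminate `a(γ)`
is `X (Sum.inl γ)` and `b(γ)` is `X (Sum.inr γ)`. -/
def chRelations (α : Γ) : Set (MvPolynomial (Γ ⊕ Γ) (RepRing Γ 1)) :=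
  {X (Sum.inl 1) - 1, X (Sum.inr 1), X (Sum.inl α), X (Sum.inr α) - 1} ∪
  {p | ∃ γ δ, p = X (Sum.inl (γ * δ)) - X (Sum.inl γ) * X (Sum.inl δ)
    - X (Sum.inr γ) * X (Sum.inr δ) * C (universalChar α)} ∪
  {p | ∃ γ δ, p = X (Sum.inr (γ * δ)) - X (Sum.inl γ) * X (Sum.inr δ)
    - X (Sum.inr γ) * X (Sum.inl δ)} ∪
  {p | ∃ γ, p = X (Sum.inl γ) ^ 2 + X (Sum.inr γ) ^ 2 * C (universalChar α)
    - C (universalChar γ)}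

/-- The `A_1(Γ)_{𝔽₂}`-algebra `A_2(Γ)^{Ch}_{u/𝔽₂, α}`. -/
def ChRing (α : Γ) : Type u :=
  MvPolynomial (Γ ⊕ Γ) (RepRing Γ 1) ⧸ Ideal.span (chRelations α)

instance (α : Γ) : CommRing (ChRing α) :=
  inferInstanceAs (CommRing (MvPolynomial (Γ ⊕ Γ) (RepRing Γ 1) ⧸ Ideal.span (chRelations α)))

def ChRing.mk (α : Γ) : MvPolynomial (Γ ⊕ Γ) (RepRing Γ 1) →+* ChRing α := Ideal.Quotient.mk _

def ChRing.base (α : Γ) : F2.{u} →+* ChRing α :=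
  (ChRing.mk α).comp (MvPolynomial.C.comp (RepRing.base Γ 1))

theorem ChRing.mk_eq_zero (α : Γ) {p : MvPolynomial (Γ ⊕ Γ) (RepRing Γ 1)}
    (hp : p ∈ chRelations α) : ChRing.mk α p = 0 :=
  Ideal.Quotient.eq_zero_iff_mem.2 (Ideal.subset_span hp)

open MvPolynomial in
/-- The universal `(a, b)`-coefficients. -/
def ChRing.universal (α : Γ) : ABCoeff Γ (ChRing α) α where
  d := ((ChRing.mk α).comp C : RepRing Γ 1 →* ChRing α).comp universalChar
  a γ := ChRing.mk α (X (Sum.inl γ))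
  b γ := ChRing.mk α (X (Sum.inr γ))
  a_one := by
    have := ChRing.mk_eq_zero α (p := X (Sum.inl 1) - 1) (by simp [chRelations])
    rw [map_sub, sub_eq_zero] at this
    simpa using this
  b_one := ChRing.mk_eq_zero α (by simp [chRelations])
  a_self := ChRing.mk_eq_zero α (by simp [chRelations])
  b_self := by
    have := ChRing.mk_eq_zero α (p := X (Sum.inr α) - 1) (by simp [chRelations])
    rw [map_sub, sub_eq_zero] at this
    simpa using this
  a_mul γ δ := by
    have := ChRing.mk_eq_zero α (Or.inl (Or.inl (Or.inr ⟨γ, δ, rfl⟩)))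
    rw [map_sub, map_sub, sub_sub, sub_eq_zero] at this
    simpa using this
  b_mul γ δ := by
    have := ChRing.mk_eq_zero α (Or.inl (Or.inr ⟨γ, δ, rfl⟩))
    rw [map_sub, map_sub, sub_sub, sub_eq_zero] at this
    simpa using this
  norm γ := by
    have := ChRing.mk_eq_zero α (Or.inr ⟨γ, rfl⟩)
    rw [map_sub, sub_eq_zero] at this
    simpa using this

/-- A character, as a representation of degree one. -/
def charRep {R : Type v} [CommRing R] (d : Γ →* R) : Γ →* Matrix (Fin 1) (Fin 1) R where
  toFun γ := Matrix.of fun _ _ => d γ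
  map_one' := by ext i j; simp [Matrix.one_apply, Subsingleton.elim i j]
  map_mul' γ δ := by ext i j; simp [Matrix.mul_apply]

theorem lift_charRep {R : Type v} [CommRing R] (c : F2.{u} →+* R) (d : Γ →* R) (γ : Γ) :
    RepRing.lift c (charRep d) (universalChar γ) = d γ :=
  (RepRing.lift_universalRep c (charRep d) γ 0 0).trans rfl

/-- The homomorphism out of `A_2(Γ)^{Ch}_{u/𝔽₂, α}` that classifies `(a, b)`-coefficients. -/
def ChRing.lift {R : Type v} [CommRing R] {α : Γ} (c : F2.{u} →+* R) (P : ABCoeff Γ R α) :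
    ChRing α →+* R :=
  Ideal.Quotient.lift _ (MvPolynomial.eval₂Hom
      (RepRing.lift c (charRep P.d))
      (Sum.elim P.a P.b)) (by
    intro p hp
    rw [← RingHom.mem_ker]
    refine (Ideal.span_le (I := RingHom.ker _)).2 ?_ hp
    rintro p (((h | ⟨γ, δ, rfl⟩) | ⟨γ, δ, rfl⟩) | ⟨γ, rfl⟩)
    · rcases h with rfl | rfl | rfl | rfl
      · simp [RingHom.mem_ker, P.a_one]
      · simp [RingHom.mem_ker, P.b_one]
      · simp [RingHom.mem_ker, P.a_self]
      · simp [RingHom.mem_ker, P.b_self]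
    · simp [RingHom.mem_ker, P.a_mul, lift_charRep]
    · simp [RingHom.mem_ker, P.b_mul]
    · simp [RingHom.mem_ker, lift_charRep, P.norm])

@[simp] theorem ChRing.map_lift {R : Type v} [CommRing R] {α : Γ} (c : F2.{u} →+* R)
    (P : ABCoeff Γ R α) : (ChRing.universal α).map (ChRing.lift c P) = P := by
  apply ABCoeff.ext_ab
  · intro γ
    change MvPolynomial.eval₂Hom _ _ (MvPolynomial.X (Sum.inl γ)) = _
    simp
  · intro γ
    change MvPolynomial.eval₂Hom _ _ (MvPolynomial.X (Sum.inr γ)) = _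
    simp

theorem ChRing.hom_ext {R : Type v} [CommRing R] {α : Γ} {f g : ChRing α →+* R}
    (h : (ChRing.universal α).map f = (ChRing.universal α).map g) : f = g := by
  apply Ideal.Quotient.ringHom_ext
  apply MvPolynomial.ringHom_ext'
  · apply RepRing.hom_ext
    intro γ i j
    obtain rfl := Subsingleton.elim i 0
    obtain rfl := Subsingleton.elim j 0
    exact DFunLike.congr_fun (congrArg ABCoeff.d h) γ
  · rintro (γ | γ)
    · exact congrFun (congrArg ABCoeff.a h) γ
    · exact congrFun (congrArg ABCoeff.b h) γ

/-- The change from `(a, b)`-coefficients with respect to `α` to those with respect to `β`, where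
`b(β)` is invertible with inverse `v`:
`a_β(γ) = a_α(γ) + a_α(β) v b_α(γ)` and `b_β(γ) = v b_α(γ)`. -/
def ABCoeff.change {R : Type v} [CommRing R] {α : Γ} (h2 : (2 : R) = 0) (P : ABCoeff Γ R α)
    (β : Γ) (v : R) (hv : P.b β * v = 1) : ABCoeff Γ R β where
  d := P.d
  a γ := P.a γ + P.a β * v * P.b γ
  b γ := v * P.b γ
  a_one := by simp [P.a_one, P.b_one]
  b_one := by simp [P.b_one]
  a_self := by linear_combination P.a β * hv + P.a β * h2
  b_self := by linear_combination hv
  a_mul γ δ := by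
    rw [← P.norm β, P.a_mul, P.b_mul]
    linear_combination (-P.a β ^ 2 * v ^ 2 * P.b γ * P.b δ) * h2
      - P.b γ * P.b δ * P.d α * (P.b β * v + 1) * hv
  b_mul γ δ := by
    rw [P.b_mul]
    linear_combination (-P.a β * v ^ 2 * P.b γ * P.b δ) * h2
  norm γ := by
    rw [← P.norm β, ← P.norm γ]
    linear_combination (P.a β ^ 2 * v ^ 2 * P.b γ ^ 2 + P.a γ * P.a β * v * P.b γ) * h2
      + P.b γ ^ 2 * P.d α * (P.b β * v + 1) * hv

end Rings

end Coordinates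

section RankTwo

/-! ### Ranks of generated algebras -/

section Field

variable {K : Type v} [Field K]

theorem apply_eq_of_trace {R : Type v} [CommRing R] (h2 : (2 : R) = 0)
    {M : Matrix (Fin 2) (Fin 2) R} (h : M.trace = 0) : M 1 1 = M 0 0 := by
  rw [Matrix.trace_fin_two] at h
  linear_combination h - M 0 0 * h2

/-- For a nonempty family of trace zero matrices over a field of characteristic two whose images
in `M₂(K)/K` are pairwise proportional, the algebra they generate is two-dimensional if and only
if one of them is not scalar. -/
theorem finrank_adjoin_eq_two_iff (h2 : (2 : K) = 0) (s : Set (Matrix (Fin 2) (Fin 2) K))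
    (hs : ∀ M ∈ s, M.trace = 0)
    (hc : ∀ M ∈ s, ∀ N ∈ s, M 0 1 * N 1 0 = M 1 0 * N 0 1) :
    Module.finrank K (Algebra.adjoin K s) = 2 ↔ ∃ M ∈ s, M 0 1 ≠ 0 ∨ M 1 0 ≠ 0 := by
  constructor
  · intro h
    by_contra! hcon
    have hbot : Algebra.adjoin K s ≤ ⊥ := by
      rw [Algebra.adjoin_le_iff]
      intro M hM
      obtain ⟨h01, h10⟩ := hcon M hM
      have h11 := apply_eq_of_trace h2 (hs M hM)
      rw [SetLike.mem_coe, Algebra.mem_bot]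
      refine ⟨M 0 0, ?_⟩
      ext i j
      fin_cases i <;> fin_cases j <;> simp [Matrix.algebraMap_matrix_apply, h01, h10, h11]
    have hb : Algebra.adjoin K s = ⊥ := le_antisymm hbot bot_le
    rw [hb, Subalgebra.finrank_bot] at h
    omega
  · rintro ⟨Z, hZ, hZ'⟩
    have hspan : ∀ M : Matrix (Fin 2) (Fin 2) K, M.trace = 0 → Z 0 1 * M 1 0 = Z 1 0 * M 0 1 →
        M ∈ Submodule.span K {1, Z} := by
      intro M hM hMZ
      have h11 := apply_eq_of_trace h2 hM
      have z11 := apply_eq_of_trace h2 (hs Z hZ)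
      rw [Submodule.mem_span_pair]
      rcases hZ' with h | h
      · refine ⟨M 0 0 - M 0 1 / Z 0 1 * Z 0 0, M 0 1 / Z 0 1, ?_⟩
        ext i j
        fin_cases i <;> fin_cases j <;> simp [h11, z11] <;> field_simp
        linear_combination -hMZ
      · refine ⟨M 0 0 - M 1 0 / Z 1 0 * Z 0 0, M 1 0 / Z 1 0, ?_⟩
        ext i j
        fin_cases i <;> fin_cases j <;> simp [h11, z11] <;> field_simp
        linear_combination hMZ
    have hZZ : Z * Z ∈ Submodule.span K {1, Z} := by
      have z11 := apply_eq_of_trace h2 (hs Z hZ)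
      apply hspan
      · simp only [Matrix.trace_fin_two, Matrix.mul_apply, Fin.sum_univ_two, z11]
        linear_combination (Z 0 0 ^ 2 + Z 0 1 * Z 1 0) * h2
      · simp only [Matrix.mul_apply, Fin.sum_univ_two, z11]
        ring
    have hadj : Subalgebra.toSubmodule (Algebra.adjoin K s) = Submodule.span K {1, Z} := by
      apply le_antisymm
      · have hmul : ∀ x y, x ∈ Submodule.span K {1, Z} → y ∈ Submodule.span K {1, Z} →
            x * y ∈ Submodule.span K {1, Z} := by
          intro x y hx hy
          obtain ⟨a, b, rfl⟩ := Submodule.mem_span_pair.1 hx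
          obtain ⟨c, d, rfl⟩ := Submodule.mem_span_pair.1 hy
          have e : (a • (1 : Matrix (Fin 2) (Fin 2) K) + b • Z) * (c • 1 + d • Z) =
              (a * c) • (1 : Matrix (Fin 2) (Fin 2) K) + (a * d + b * c) • Z +
                (b * d) • (Z * Z) := by
            simp only [mul_add, add_mul, smul_mul_smul_comm, one_mul, mul_one, add_smul]
            abel
          rw [e]
          exact add_mem (add_mem (Submodule.smul_mem _ _ (Submodule.subset_span (by simp)))
            (Submodule.smul_mem _ _ (Submodule.subset_span (by simp))))
            (Submodule.smul_mem _ _ hZZ)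
        let S : Subalgebra K (Matrix (Fin 2) (Fin 2) K) :=
          Submodule.toSubalgebra (Submodule.span K {1, Z})
            (Submodule.subset_span (by simp)) hmul
        have : Algebra.adjoin K s ≤ S := by
          rw [Algebra.adjoin_le_iff]
          intro M hM
          exact hspan M (hs M hM) (hc Z hZ M hM)
        exact this
      · rw [Submodule.span_le]
        rintro x (rfl | rfl)
        · exact one_mem (Algebra.adjoin K s)
        · exact Algebra.subset_adjoin hZ
    have hli : LinearIndependent K ![(1 : Matrix (Fin 2) (Fin 2) K), Z] := by
      rw [LinearIndependent.pair_iff]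
      intro a b hab
      have hb : b = 0 := by
        rcases hZ' with h | h
        · have := congrFun (congrFun hab 0) 1
          simpa [h] using this
        · have := congrFun (congrFun hab 1) 0
          simpa [h] using this
      have := congrFun (congrFun hab 0) 0
      simp [hb] at this
      exact ⟨this, hb⟩
    have := finrank_span_eq_card hli
    have hr : Set.range ![(1 : Matrix (Fin 2) (Fin 2) K), Z] = {1, Z} := by
      simp [Set.pair_comm]
    rw [hr, ← hadj] at this
    simpa using this

end Field

/-! ### Sections on schemes -/

/-- The matrix over the residue field at `x` obtained by evaluation. -/
def evalAt {X : Scheme.{u}} (x : X) (M : Matrix (Fin 2) (Fin 2) Γ(X, ⊤)) :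
    Matrix (Fin 2) (Fin 2) (X.residueField x) :=
  M.map (X.Γevaluation x).hom

/-- The dimension of the `κ(x)`-subalgebra of `M₂(κ(x))` generated by the values at `x` of a set
of matrices. -/
def generatedRank {X : Scheme.{u}} (s : Set (Matrix (Fin 2) (Fin 2) Γ(X, ⊤))) (x : X) : ℕ :=
  Module.finrank (X.residueField x) (Algebra.adjoin (X.residueField x) (evalAt x '' s))

/-- The open set where one of the off-diagonal entries of `M` does not vanish. -/
def offDiag {X : Scheme.{u}} (M : Matrix (Fin 2) (Fin 2) Γ(X, ⊤)) : X.Opens :=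
  X.basicOpen (M 0 1) ⊔ X.basicOpen (M 1 0)

theorem mem_offDiag {X : Scheme.{u}} (M : Matrix (Fin 2) (Fin 2) Γ(X, ⊤)) (x : X) :
    x ∈ offDiag M ↔ evalAt x M 0 1 ≠ 0 ∨ evalAt x M 1 0 ≠ 0 := by
  have h (f : Γ(X, ⊤)) := Scheme.evaluation_ne_zero_iff_mem_basicOpen X (U := ⊤) x trivial f
  change (x ∈ X.basicOpen (M 0 1) ∨ x ∈ X.basicOpen (M 1 0)) ↔ _
  rw [← h, ← h]
  rfl

theorem preimage_offDiag {X Y : Scheme.{u}} (f : X ⟶ Y) (M : Matrix (Fin 2) (Fin 2) Γ(Y, ⊤)) :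
    f ⁻¹ᵁ offDiag M = offDiag (M.map f.appTop.hom) := by
  ext x
  change (x ∈ f ⁻¹ᵁ Y.basicOpen (M 0 1) ∨ x ∈ f ⁻¹ᵁ Y.basicOpen (M 1 0)) ↔ _
  rw [Scheme.preimage_basicOpen_top, Scheme.preimage_basicOpen_top]
  rfl

variable {Γ : Type u} [Monoid Γ]

theorem TraceZeroRep.cross {R : Type v} [CommRing R] (P : TraceZeroRep Γ R)
    (γ δ : Γ) : P.rep γ 0 1 * P.rep δ 1 0 = P.rep γ 1 0 * P.rep δ 0 1 := by
  have := P.minor_eq_zero ![1, γ, δ] ![(0, 0), (0, 1), (1, 0)]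
  rw [Matrix.det_fin_three] at this
  simp at this
  linear_combination this

theorem two_eq_zero_residueField {X : Scheme.{u}} (h2 : (2 : Γ(X, ⊤)) = 0) (x : X) :
    (2 : X.residueField x) = 0 := by
  have := congrArg (X.Γevaluation x).hom h2
  rwa [map_ofNat, map_zero] at this

theorem generatedRank_eq_two_iff {X : Scheme.{u}} (h2 : (2 : Γ(X, ⊤)) = 0)
    (P : TraceZeroRep Γ Γ(X, ⊤)) (t : Set Γ) (x : X) :
    generatedRank (P.rep '' t) x = 2 ↔ ∃ γ ∈ t, x ∈ offDiag (P.rep γ) := by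
  rw [generatedRank, finrank_adjoin_eq_two_iff (two_eq_zero_residueField h2 x)]
  · simp [mem_offDiag]
  · rintro _ ⟨_, ⟨γ, -, rfl⟩, rfl⟩
    exact (P.map (X.Γevaluation x).hom).trace_eq_zero γ
  · rintro _ ⟨_, ⟨γ, -, rfl⟩, rfl⟩ _ ⟨_, ⟨δ, -, rfl⟩, rfl⟩
    exact (P.map (X.Γevaluation x).hom).cross γ δ

/-! ### The unipotent part of the representation variety -/

variable (Γ) in
/-- The closed subscheme of `Rep_2(Γ)_{𝔽₂}` where all `3 × 3` minors and all traces vanish. -/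
abbrev repLe : Scheme.{u} := Spec (CommRingCat.of (UnipRing Γ))

/-- The identification of `Γ(Spec R, 𝒪)` with `R`. -/
def toGlobal (R : Type u) [CommRing R] : R →+* Γ(Spec (CommRingCat.of R), ⊤) :=
  (Scheme.ΓSpecIso (CommRingCat.of R)).inv.hom

variable (Γ) in
/-- The universal representation on `repLe Γ`. -/
def repLeRep : TraceZeroRep Γ Γ(repLe Γ, ⊤) :=
  (UnipRing.universal Γ).map (toGlobal (UnipRing Γ))

variable (Γ) in
theorem repLe_two : (2 : Γ(repLe Γ, ⊤)) = 0 :=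
  F2.two_eq_zero ((toGlobal (UnipRing Γ)).comp (UnipRing.base Γ))

variable (Γ) in
/-- The open subset of `repLe Γ` of those points `x` such that the image of the universal
representation generates a two-dimensional algebra over the residue field of `x`. -/
def repOpens : (repLe Γ).Opens where
  carrier := {x | generatedRank (Set.range (repLeRep Γ).rep) x = 2}
  is_open' := by
    have : {x | generatedRank (Set.range (repLeRep Γ).rep) x = 2} =
        ⋃ γ, (offDiag ((repLeRep Γ).rep γ) : Set (repLe Γ)) := by
      ext x
      rw [← Set.image_univ, Set.mem_ofPred_eq, generatedRank_eq_two_iff (repLe_two Γ)]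
      simp
    rw [this]
    exact isOpen_iUnion fun γ => (offDiag _).isOpen

/-- The open subset of `repLe Γ` of those points `x` such that the value of the universal
representation at `γ` generates a two-dimensional algebra over the residue field of `x`. -/
def repOpensAt (γ : Γ) : (repLe Γ).Opens where
  carrier := {x | generatedRank {(repLeRep Γ).rep γ} x = 2}
  is_open' := by
    have : {x | generatedRank {(repLeRep Γ).rep γ} x = 2} =
        (offDiag ((repLeRep Γ).rep γ) : Set (repLe Γ)) := by
      ext x
      rw [← Set.image_singleton, Set.mem_ofPred_eq, generatedRank_eq_two_iff (repLe_two Γ)]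
      simp
    rw [this]
    exact (offDiag _).isOpen

theorem repOpensAt_eq (γ : Γ) : repOpensAt γ = offDiag ((repLeRep Γ).rep γ) := by
  ext x
  change generatedRank {(repLeRep Γ).rep γ} x = 2 ↔ _
  rw [← Set.image_singleton, generatedRank_eq_two_iff (repLe_two Γ)]
  simp

variable (Γ) in
theorem repOpens_eq : repOpens Γ = ⨆ γ : Γ, repOpensAt γ := by
  ext x
  change generatedRank (Set.range (repLeRep Γ).rep) x = 2 ↔ _
  rw [← Set.image_univ, generatedRank_eq_two_iff (repLe_two Γ)]
  simp [repOpensAt_eq]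

end RankTwo

section Coefficients

/-! ### Division of proportional families of sections -/

theorem existsUnique_ratio {X : Scheme.{u}} {ι : Type u} (v w : ι → Γ(X, ⊤))
    (hcov : ⨆ i, X.basicOpen (v i) = ⊤) (hc : ∀ i j, v i * w j = v j * w i) :
    ∃! b : Γ(X, ⊤), ∀ i, w i = b * v i := by
  let U : ι → X.Opens := fun i => X.basicOpen (v i)
  let r : ∀ i, Γ(X, ⊤) →+* Γ(X, U i) := fun i => (X.presheaf.map (homOfLE le_top).op).hom
  have hu : ∀ i, IsUnit (r i (v i)) := fun i =>
    X.toLocallyRingedSpace.toRingedSpace.isUnit_res_basicOpen (v i)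
  choose q hq using fun i => (hu i).exists_right_inv
  have key : ∀ (V : X.Opens) (i : ι) (h : V ≤ U i) (j : ι),
      X.presheaf.map (homOfLE h).op (r i (w i) * q i) *
        X.presheaf.map (homOfLE (le_top : V ≤ ⊤)).op (v j) =
        X.presheaf.map (homOfLE (le_top : V ≤ ⊤)).op (w j) := by
    intro V i h j
    have e : ∀ f : Γ(X, ⊤), X.presheaf.map (homOfLE (le_top : V ≤ ⊤)).op f =
        X.presheaf.map (homOfLE h).op (r i f) := by
      intro f
      rw [show r i f = X.presheaf.map (homOfLE le_top).op f from rfl,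
        ← CommRingCat.comp_apply, ← X.presheaf.map_comp]
      rfl
    rw [e, e, ← map_mul]
    congr 1
    have h1 := congrArg (r i) (hc i j)
    rw [map_mul, map_mul] at h1
    linear_combination (r i (w j)) * hq i - q i * h1
  have hcomp : TopCat.Presheaf.IsCompatible X.sheaf.1 U (fun i => r i (w i) * q i) := by
    intro i j
    have hi := key (U i ⊓ U j) i inf_le_left i
    have hj := key (U i ⊓ U j) j inf_le_right i
    have hun : IsUnit (X.presheaf.map (homOfLE (le_top : U i ⊓ U j ≤ ⊤)).op (v i)) := by
      have := (hu i).map (X.presheaf.map (homOfLE (inf_le_left : U i ⊓ U j ≤ U i)).op).hom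
      convert this using 1
      rw [show r i (v i) = X.presheaf.map (homOfLE le_top).op (v i) from rfl]
      change _ = (X.presheaf.map _ ≫ X.presheaf.map _) _
      rw [← X.presheaf.map_comp]
      rfl
    exact hun.mul_right_cancel (hi.trans hj.symm)
  obtain ⟨(b : Γ(X, ⊤)), hb, -⟩ := X.sheaf.existsUnique_gluing' U ⊤ (fun i => homOfLE le_top)
    (by rw [← hcov]) _ hcomp
  have huniq : ∀ s t : Γ(X, ⊤), (∀ i, r i s = r i t) → s = t := fun s t h =>
    X.sheaf.eq_of_locally_eq' U ⊤ (fun i => homOfLE le_top) (by rw [← hcov]) s t h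
  have hb' : ∀ i, r i b = r i (w i) * q i := hb
  refine ⟨b, fun j => huniq _ _ fun i => ?_, fun c hc' => huniq _ _ fun i => ?_⟩
  · rw [map_mul, hb']
    have h1 := congrArg (r i) (hc i j)
    rw [map_mul, map_mul] at h1
    linear_combination -(r i (w j)) * hq i + q i * h1
  · rw [hb', hc' i, map_mul]
    linear_combination -(r i c) * hq i

variable {Γ : Type u} [Monoid Γ]

theorem smul_cancel_of_offDiag {X : Scheme.{u}} {M : Matrix (Fin 2) (Fin 2) Γ(X, ⊤)}
    (hM : offDiag M = ⊤) {a b a' b' : Γ(X, ⊤)}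
    (h : a • (1 : Matrix (Fin 2) (Fin 2) Γ(X, ⊤)) + b • M = a' • 1 + b' • M) :
    a = a' ∧ b = b' := by
  have h01 : b * M 0 1 = b' * M 0 1 := by simpa using congrFun (congrFun h 0) 1
  have h10 : b * M 1 0 = b' * M 1 0 := by simpa using congrFun (congrFun h 1) 0
  have hb : b = b' := by
    obtain ⟨c, -, hc⟩ := existsUnique_ratio (X := X) (ι := ULift.{u} Bool)
      (fun i => if i.down then M 0 1 else M 1 0)
      (fun i => b * if i.down then M 0 1 else M 1 0)
      (by
        refine Eq.trans ?_ hM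
        apply le_antisymm
        · refine iSup_le ?_
          rintro ⟨_ | _⟩
          · exact le_sup_right
          · exact le_sup_left
        · exact sup_le (le_iSup_of_le ⟨true⟩ le_rfl) (le_iSup_of_le ⟨false⟩ le_rfl))
      (fun i j => by ring)
    rw [hc b fun i => rfl, hc b' ?_]
    rintro ⟨_ | _⟩
    · exact h10
    · exact h01
  subst hb
  have h00 : a + b * M 0 0 = a' + b * M 0 0 := by simpa using congrFun (congrFun h 0) 0
  exact ⟨by simpa using h00, rfl⟩

/-- If the off-diagonal entries of `ρ(α)` have no common zero, then there are unique functions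
`a`, `b` with `ρ(γ) = a(γ) + b(γ) ρ(α)`; they are `(a, b)`-coefficients with respect to
`(det ρ, α)`. -/
theorem TraceZeroRep.existsUnique_coeff {X : Scheme.{u}} (h2 : (2 : Γ(X, ⊤)) = 0)
    (P : TraceZeroRep Γ Γ(X, ⊤)) (α : Γ) (hα : offDiag (P.rep α) = ⊤) :
    ∃! Q : ABCoeff Γ Γ(X, ⊤) α, ∀ γ, P.rep γ = Q.a γ • 1 + Q.b γ • P.rep α := by
  have hex : ∀ γ, ∃ a b : Γ(X, ⊤), P.rep γ = a • 1 + b • P.rep α := by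
    intro γ
    obtain ⟨b, hb, -⟩ := existsUnique_ratio (X := X) (ι := ULift.{u} Bool)
      (fun i => if i.down then P.rep α 0 1 else P.rep α 1 0)
      (fun i => if i.down then P.rep γ 0 1 else P.rep γ 1 0)
      (by
        refine Eq.trans ?_ hα
        apply le_antisymm
        · refine iSup_le ?_
          rintro ⟨_ | _⟩
          · exact le_sup_right
          · exact le_sup_left
        · exact sup_le (le_iSup_of_le ⟨true⟩ le_rfl) (le_iSup_of_le ⟨false⟩ le_rfl))
      (by
        have := P.cross α γ
        rintro ⟨_ | _⟩ ⟨_ | _⟩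
        · rfl
        · exact this.symm
        · exact this
        · rfl)
    have h01 : P.rep γ 0 1 = b * P.rep α 0 1 := hb ⟨true⟩
    have h10 : P.rep γ 1 0 = b * P.rep α 1 0 := hb ⟨false⟩
    have hg := apply_eq_of_trace h2 (P.trace_eq_zero γ)
    have ha := apply_eq_of_trace h2 (P.trace_eq_zero α)
    refine ⟨P.rep γ 0 0 - b * P.rep α 0 0, b, ?_⟩
    ext i j
    fin_cases i <;> fin_cases j <;> simp [h01, h10, hg, ha]
  choose a b hab using hex
  have hsq : P.rep α * P.rep α = (P.rep α).det • (1 : Matrix (Fin 2) (Fin 2) Γ(X, ⊤)) := by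
    have ha := apply_eq_of_trace h2 (P.trace_eq_zero α)
    ext i j
    fin_cases i <;> fin_cases j <;>
      simp only [Matrix.mul_apply, Fin.sum_univ_two, Matrix.det_fin_two, ha, Fin.zero_eta,
        Fin.mk_one, Matrix.smul_apply, Matrix.one_apply, smul_eq_mul]
    · simp only [if_true]
      linear_combination (P.rep α 0 1 * P.rep α 1 0) * h2
    · simp only [zero_ne_one, if_false]
      linear_combination (P.rep α 0 1 * P.rep α 0 0) * h2
    · simp only [one_ne_zero, if_false]
      linear_combination (P.rep α 1 0 * P.rep α 0 0) * h2
    · simp only [if_true]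
      linear_combination (P.rep α 0 1 * P.rep α 1 0) * h2
  have hone := smul_cancel_of_offDiag hα (a := a 1) (b := b 1) (a' := 1) (b' := 0)
    (by rw [← hab, map_one]; simp)
  have hself := smul_cancel_of_offDiag hα (a := a α) (b := b α) (a' := 0) (b' := 1)
    (by rw [← hab]; simp)
  have hmul := fun γ δ => smul_cancel_of_offDiag hα (a := a (γ * δ)) (b := b (γ * δ))
    (a' := a γ * a δ + b γ * b δ * (P.rep α).det) (b' := a γ * b δ + b γ * a δ)
    (by
      rw [← hab, map_mul, hab γ, hab δ]
      simp only [mul_add, add_mul, smul_mul_smul_comm, one_mul, mul_one, add_smul, hsq, smul_smul]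
      abel)
  refine ⟨⟨(Matrix.detMonoidHom).comp P.rep, a, b, hone.1, hone.2, hself.1, hself.2,
    fun γ δ => (hmul γ δ).1, fun γ δ => (hmul γ δ).2, fun γ => ?_⟩, hab, ?_⟩
  · change _ = (P.rep γ).det
    have ha := apply_eq_of_trace h2 (P.trace_eq_zero α)
    change a γ ^ 2 + b γ ^ 2 * (P.rep α).det = _
    rw [hab γ]
    simp only [Matrix.det_fin_two, Matrix.add_apply, Matrix.smul_apply, Matrix.one_apply, ha,
      smul_eq_mul]
    simp
    linear_combination (-a γ * b γ * P.rep α 0 0) * h2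
  · intro Q hQ
    refine ABCoeff.ext_ab (fun γ => ?_) (fun γ => ?_)
    · exact (smul_cancel_of_offDiag hα ((hQ γ).symm.trans (hab γ))).1
    · exact (smul_cancel_of_offDiag hα ((hQ γ).symm.trans (hab γ))).2

/-- The `(a, b)`-coefficients of a representation on `X` with respect to `α`. -/
def TraceZeroRep.coeff {X : Scheme.{u}} (h2 : (2 : Γ(X, ⊤)) = 0)
    (P : TraceZeroRep Γ Γ(X, ⊤)) (α : Γ) (hα : offDiag (P.rep α) = ⊤) :
    ABCoeff Γ Γ(X, ⊤) α :=
  (P.existsUnique_coeff h2 α hα).choose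

theorem TraceZeroRep.coeff_spec {X : Scheme.{u}} (h2 : (2 : Γ(X, ⊤)) = 0)
    (P : TraceZeroRep Γ Γ(X, ⊤)) (α : Γ) (hα : offDiag (P.rep α) = ⊤) (γ : Γ) :
    P.rep γ = (P.coeff h2 α hα).a γ • 1 + (P.coeff h2 α hα).b γ • P.rep α :=
  (P.existsUnique_coeff h2 α hα).choose_spec.1 γ

theorem TraceZeroRep.coeff_unique {X : Scheme.{u}} (h2 : (2 : Γ(X, ⊤)) = 0)
    (P : TraceZeroRep Γ Γ(X, ⊤)) (α : Γ) (hα : offDiag (P.rep α) = ⊤)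
    (Q : ABCoeff Γ Γ(X, ⊤) α) (hQ : ∀ γ, P.rep γ = Q.a γ • 1 + Q.b γ • P.rep α) :
    P.coeff h2 α hα = Q :=
  ((P.existsUnique_coeff h2 α hα).choose_spec.2 Q hQ).symm

theorem TraceZeroRep.coeff_map {X Y : Scheme.{u}} (f : X ⟶ Y) (h2 : (2 : Γ(Y, ⊤)) = 0)
    (h2' : (2 : Γ(X, ⊤)) = 0)
    (P : TraceZeroRep Γ Γ(Y, ⊤)) (α : Γ) (hα : offDiag (P.rep α) = ⊤)
    (hα' : offDiag ((P.map f.appTop.hom).rep α) = ⊤) :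
    (P.coeff h2 α hα).map f.appTop.hom = (P.map f.appTop.hom).coeff h2' α hα' := by
  symm
  apply TraceZeroRep.coeff_unique
  intro γ
  rw [TraceZeroRep.map_rep, P.coeff_spec h2 α hα γ]
  ext i j
  simp [Matrix.one_apply, apply_ite f.appTop.hom]

/-- On a scheme where the off-diagonal entries of `ρ(α)` have no common zero and likewise for
`ρ(β)`, the value `b_α(β)` is invertible with inverse `b_β(α)`, and the two systems of
`(a, b)`-coefficients are related by the change of coefficients. -/
theorem TraceZeroRep.coeff_change {X : Scheme.{u}} (h2 : (2 : Γ(X, ⊤)) = 0)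
    (P : TraceZeroRep Γ Γ(X, ⊤)) (α β : Γ) (hα : offDiag (P.rep α) = ⊤)
    (hβ : offDiag (P.rep β) = ⊤) :
    ∃ hv : (P.coeff h2 α hα).b β * (P.coeff h2 β hβ).b α = 1,
      P.coeff h2 β hβ = (P.coeff h2 α hα).change h2 β _ hv := by
  set A := P.coeff h2 α hα with hA
  set B := P.coeff h2 β hβ with hB
  have hA' := P.coeff_spec h2 α hα
  have hB' := P.coeff_spec h2 β hβ
  rw [← hA] at hA'
  rw [← hB] at hB'
  have h : A.b β * B.b α = 1 := by
    have e : (0 : Γ(X, ⊤)) • (1 : Matrix (Fin 2) (Fin 2) Γ(X, ⊤)) + (1 : Γ(X, ⊤)) • P.rep α =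
        (B.a α + B.b α * A.a β) • 1 + (A.b β * B.b α) • P.rep α := by
      have h1 := hB' α
      rw [hA' β] at h1
      nth_rewrite 1 [h1]
      simp only [smul_add, smul_smul, add_smul, zero_smul, one_mul, zero_add]
      rw [mul_comm (A.b β)]
      abel
    exact ((smul_cancel_of_offDiag hα e).2).symm
  refine ⟨h, P.coeff_unique h2 β hβ _ fun γ => ?_⟩
  have h1 := hA' γ
  have e2 : P.rep α = (A.a β * B.b α) • 1 + B.b α • P.rep β := by
    rw [hA' β]
    simp only [smul_add, smul_smul, mul_comm (B.b α), h, one_smul]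
    rw [← add_assoc, ← add_smul, show A.a β * B.b α + A.a β * B.b α = 0 by
      linear_combination (A.a β * B.b α) * h2, zero_smul, zero_add]
  rw [e2] at h1
  rw [h1]
  simp only [ABCoeff.change, smul_add, smul_smul, add_smul]
  rw [mul_comm (A.b γ) (A.a β * B.b α), mul_comm (A.b γ) (B.b α)]
  abel

end Coefficients

section Gluing

/-! ### Morphisms to affine schemes -/

section ToSpec

variable {T T' : Scheme.{u}} {R : Type u} [CommRing R]

def toSpec (φ : R →+* Γ(T, ⊤)) : T ⟶ Spec (CommRingCat.of R) :=
  T.toSpecΓ ≫ Spec.map (CommRingCat.ofHom φ)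

def pull (f : T ⟶ Spec (CommRingCat.of R)) : R →+* Γ(T, ⊤) :=
  f.appTop.hom.comp (toGlobal R)

theorem pull_comp (g : T' ⟶ T) (f : T ⟶ Spec (CommRingCat.of R)) :
    pull (g ≫ f) = g.appTop.hom.comp (pull f) := by
  rw [pull, pull, Scheme.Hom.comp_appTop, CommRingCat.hom_comp, RingHom.comp_assoc]

theorem ofHom_pull (f : T ⟶ Spec (CommRingCat.of R)) :
    CommRingCat.ofHom (pull f) = (Scheme.ΓSpecIso (CommRingCat.of R)).inv ≫ f.appTop := rfl

theorem pull_toSpec (φ : R →+* Γ(T, ⊤)) : pull (toSpec φ) = φ := by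
  have : CommRingCat.ofHom (pull (toSpec φ)) = CommRingCat.ofHom φ := by
    rw [ofHom_pull, toSpec, Scheme.Hom.comp_appTop, Scheme.toSpecΓ_appTop,
      ← Scheme.ΓSpecIso_inv_naturality_assoc]
    simp
  exact congrArg CommRingCat.Hom.hom this

theorem toSpec_pull (f : T ⟶ Spec (CommRingCat.of R)) : toSpec (pull f) = f := by
  rw [toSpec, ofHom_pull, Spec.map_comp, ← Scheme.toSpecΓ_naturality_assoc,
    toSpecΓ_SpecMap_ΓSpecIso_inv, Category.comp_id]

theorem hom_ext_of_pull {f g : T ⟶ Spec (CommRingCat.of R)} (h : pull f = pull g) : f = g := by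
  rw [← toSpec_pull f, ← toSpec_pull g, h]

theorem pull_comp_specMap {R' : Type u} [CommRing R'] (f : T ⟶ Spec (CommRingCat.of R))
    (φ : R' →+* R) : pull (f ≫ Spec.map (CommRingCat.ofHom φ)) = (pull f).comp φ := by
  have : CommRingCat.ofHom (pull (f ≫ Spec.map (CommRingCat.ofHom φ))) =
      CommRingCat.ofHom φ ≫ CommRingCat.ofHom (pull f) := by
    rw [ofHom_pull, ofHom_pull, Scheme.Hom.comp_appTop, ← Scheme.ΓSpecIso_inv_naturality_assoc]
  exact congrArg CommRingCat.Hom.hom this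

end ToSpec

/-- The base scheme `Spec 𝔽₂`. -/
abbrev baseScheme : Scheme.{u} := Spec (CommRingCat.of F2.{u})

theorem baseScheme_hom_ext {T : Scheme.{u}} (f g : T ⟶ baseScheme.{u}) : f = g :=
  hom_ext_of_pull (F2.subsingleton_hom _ _)

variable {Γ : Type u} [Monoid Γ]

/-! ### Gluing the affine schemes `Ch_2(Γ)_{u/𝔽₂, α}` -/

/-- The affine scheme `Ch_2(Γ)_{u/𝔽₂, α}`. -/
abbrev chAffine (α : Γ) : Scheme.{u} := Spec (CommRingCat.of (ChRing α))

/-- The `(a, b)`-coefficients on `T` given by a morphism `T ⟶ Ch_2(Γ)_{u/𝔽₂, α}`. -/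
def coeffOf {T : Scheme.{u}} {α : Γ} (g : T ⟶ chAffine α) : ABCoeff Γ Γ(T, ⊤) α :=
  (ChRing.universal α).map (pull g)

/-- The morphism `T ⟶ Ch_2(Γ)_{u/𝔽₂, α}` classifying `(a, b)`-coefficients on `T`. -/
def ofCoeff {T : Scheme.{u}} {α : Γ} (c : F2.{u} →+* Γ(T, ⊤)) (Q : ABCoeff Γ Γ(T, ⊤) α) :
    T ⟶ chAffine α :=
  toSpec (ChRing.lift c Q)

@[simp] theorem coeffOf_ofCoeff {T : Scheme.{u}} {α : Γ} (c : F2.{u} →+* Γ(T, ⊤))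
    (Q : ABCoeff Γ Γ(T, ⊤) α) : coeffOf (ofCoeff c Q) = Q := by
  rw [coeffOf, ofCoeff, pull_toSpec, ChRing.map_lift]

theorem coeffOf_injective {T : Scheme.{u}} {α : Γ} {g h : T ⟶ chAffine α}
    (e : coeffOf g = coeffOf h) : g = h :=
  hom_ext_of_pull (ChRing.hom_ext e)

theorem coeffOf_comp {T T' : Scheme.{u}} {α : Γ} (h : T' ⟶ T) (g : T ⟶ chAffine α) :
    coeffOf (h ≫ g) = (coeffOf g).map h.appTop.hom := by
  rw [coeffOf, coeffOf]
  erw [pull_comp h g]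
  rfl

def baseOf {T : Scheme.{u}} {α : Γ} (g : T ⟶ chAffine α) : F2.{u} →+* Γ(T, ⊤) :=
  (pull g).comp (ChRing.base α)

/-- Change of coefficients for morphisms. -/
def changeHom {T : Scheme.{u}} {α : Γ} (β : Γ) (g : T ⟶ chAffine α)
    (h : IsUnit ((coeffOf g).b β)) : T ⟶ chAffine β :=
  ofCoeff (baseOf g) ((coeffOf g).change (F2.two_eq_zero (baseOf g)) β ↑h.unit⁻¹
    h.mul_val_inv)

theorem ABCoeff.change_self {R : Type v} [CommRing R] {α : Γ} (h2 : (2 : R) = 0)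
    (P : ABCoeff Γ R α) (v : R) (hv : P.b α * v = 1) : P.change h2 α v hv = P := by
  have : v = 1 := by simpa [P.b_self] using hv
  apply ABCoeff.ext_ab <;> intro γ <;> simp [ABCoeff.change, this, P.a_self]

theorem ABCoeff.change_change {R : Type v} [CommRing R] {α : Γ} (h2 : (2 : R) = 0)
    (P : ABCoeff Γ R α) (β γ : Γ) (v v' v'' : R) (hv : P.b β * v = 1)
    (Q : ABCoeff Γ R β) (e : Q = P.change h2 β v hv)
    (hv' : Q.b γ * v' = 1) (hv'' : P.b γ * v'' = 1) :
    Q.change h2 γ v' hv' = P.change h2 γ v'' hv'' := by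
  subst e
  simp only [ABCoeff.change] at hv'
  have hvv : v'' = v * v' := by linear_combination -v'' * hv' + v * v' * hv''
  subst hvv
  apply ABCoeff.ext_ab
  · intro δ
    simp only [ABCoeff.change]
    linear_combination (P.a β * v * P.b δ) * hv' + (P.a β * v * P.b δ) * h2
  · intro δ
    simp only [ABCoeff.change]
    ring

theorem ABCoeff.change_map {R : Type v} [CommRing R] {R' : Type w} [CommRing R'] {α : Γ}
    (f : R →+* R') (h2 : (2 : R) = 0) (h2' : (2 : R') = 0)
    (P : ABCoeff Γ R α) (Q : ABCoeff Γ R' α) (e : Q = P.map f) (β : Γ) (v : R) (v' : R')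
    (hv : P.b β * v = 1) (hv' : Q.b β * v' = 1) :
    (P.change h2 β v hv).map f = Q.change h2' β v' hv' := by
  subst e
  have : v' = f v := by
    have h1 := congrArg f hv
    rw [map_mul, map_one] at h1
    simp only [ABCoeff.map_b] at hv'
    linear_combination -v' * h1 + f v * hv'
  subst this
  apply ABCoeff.ext_ab <;> intro γ <;> simp [ABCoeff.change]

theorem coeffOf_changeHom {T : Scheme.{u}} {α : Γ} (β : Γ) (g : T ⟶ chAffine α)
    (h : IsUnit ((coeffOf g).b β)) (h2 : (2 : Γ(T, ⊤)) = 0) (v : Γ(T, ⊤))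
    (hv : (coeffOf g).b β * v = 1) :
    coeffOf (changeHom β g h) = (coeffOf g).change h2 β v hv := by
  rw [changeHom, coeffOf_ofCoeff]
  have : v = ↑h.unit⁻¹ := by
    linear_combination -v * h.mul_val_inv + ↑h.unit⁻¹ * hv
  subst this
  rfl

theorem changeHom_b {T : Scheme.{u}} {α : Γ} (β γ : Γ) (g : T ⟶ chAffine α)
    (h : IsUnit ((coeffOf g).b β)) (hγ : IsUnit ((coeffOf g).b γ)) :
    IsUnit ((coeffOf (changeHom β g h)).b γ) := by
  rw [coeffOf_changeHom β g h (F2.two_eq_zero (baseOf g)) _ h.mul_val_inv]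
  exact (Units.isUnit _).mul hγ

theorem isUnit_coeffOf_comp {T T' : Scheme.{u}} {α β : Γ} (k : T' ⟶ T) (g : T ⟶ chAffine α)
    (h : IsUnit ((coeffOf g).b β)) : IsUnit ((coeffOf (k ≫ g)).b β) := by
  rw [coeffOf_comp]
  exact h.map k.appTop.hom

theorem comp_changeHom {T T' : Scheme.{u}} {α : Γ} (β : Γ) (k : T' ⟶ T) (g : T ⟶ chAffine α)
    (h : IsUnit ((coeffOf g).b β)) :
    k ≫ changeHom β g h = changeHom β (k ≫ g) (isUnit_coeffOf_comp k g h) := by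
  apply coeffOf_injective
  have h' := isUnit_coeffOf_comp k g h
  rw [coeffOf_comp, coeffOf_changeHom β g h (F2.two_eq_zero (baseOf g)) _ h.mul_val_inv,
    coeffOf_changeHom β (k ≫ g) h' (F2.two_eq_zero (baseOf (k ≫ g))) _ h'.mul_val_inv]
  exact ABCoeff.change_map _ _ _ _ _ (coeffOf_comp k g) _ _ _ _ _

theorem changeHom_self {T : Scheme.{u}} {α : Γ} (g : T ⟶ chAffine α)
    (h : IsUnit ((coeffOf g).b α)) : changeHom α g h = g := by
  apply coeffOf_injective
  rw [coeffOf_changeHom α g h (F2.two_eq_zero (baseOf g)) _ h.mul_val_inv, ABCoeff.change_self]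

theorem changeHom_changeHom {T : Scheme.{u}} {α : Γ} (β γ : Γ) (g : T ⟶ chAffine α)
    (h : IsUnit ((coeffOf g).b β)) (h' : IsUnit ((coeffOf (changeHom β g h)).b γ))
    (h'' : IsUnit ((coeffOf g).b γ)) :
    changeHom γ (changeHom β g h) h' = changeHom γ g h'' := by
  apply coeffOf_injective
  have h2 : (2 : Γ(T, ⊤)) = 0 := F2.two_eq_zero (baseOf g)
  have e := coeffOf_changeHom β g h h2 _ h.mul_val_inv
  rw [coeffOf_changeHom γ _ h' h2 _ h'.mul_val_inv, coeffOf_changeHom γ g h'' h2 _ h''.mul_val_inv]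
  exact ABCoeff.change_change _ _ _ _ _ _ _ _ _ e _ _

/-- The open subscheme `U_{α, β} = {b(β) ≠ 0}` of `Ch_2(Γ)_{u/𝔽₂, α}`: the spectrum of
`A_2(Γ)^{Ch}_{u/𝔽₂, α}[b_α(β)⁻¹]`. -/
abbrev chInter (α β : Γ) : Scheme.{u} :=
  Spec (CommRingCat.of (Localization.Away ((ChRing.universal α).b β)))

/-- The inclusion of `U_{α, β}` in `Ch_2(Γ)_{u/𝔽₂, α}`. -/
def chIncl (α β : Γ) : chInter α β ⟶ chAffine α :=
  Spec.map (CommRingCat.ofHom (algebraMap (ChRing α)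
    (Localization.Away ((ChRing.universal α).b β))))

instance (α β : Γ) : IsOpenImmersion (chIncl α β) :=
  IsOpenImmersion.of_isLocalization ((ChRing.universal α).b β)

theorem isUnit_chIncl (α β : Γ) : IsUnit ((coeffOf (chIncl α β)).b β) := by
  have h1 : pull (chIncl α β) = (pull (𝟙 (chInter α β))).comp (algebraMap (ChRing α)
    (Localization.Away ((ChRing.universal α).b β))) := by
    rw [← pull_comp_specMap, Category.id_comp]
    rfl
  have h2 : (coeffOf (chIncl α β)).b β = pull (𝟙 (chInter α β))
      (algebraMap (ChRing α) (Localization.Away ((ChRing.universal α).b β))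
        ((ChRing.universal α).b β)) :=
    DFunLike.congr_fun h1 ((ChRing.universal α).b β)
  rw [h2]
  exact (IsLocalization.Away.algebraMap_isUnit _).map _

/-- A morphism to `Ch_2(Γ)_{u/𝔽₂, α}` for which `b(β)` is invertible factors through
`U_{α, β}`. -/
def liftInter {T : Scheme.{u}} {α : Γ} (β : Γ) (g : T ⟶ chAffine α)
    (h : IsUnit ((coeffOf g).b β)) : T ⟶ chInter α β :=
  toSpec (IsLocalization.Away.lift (S := Localization.Away ((ChRing.universal α).b β))
    ((ChRing.universal α).b β) (g := pull g) h)

theorem liftInter_chIncl {T : Scheme.{u}} {α : Γ} (β : Γ) (g : T ⟶ chAffine α)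
    (h : IsUnit ((coeffOf g).b β)) : liftInter β g h ≫ chIncl α β = g := by
  apply hom_ext_of_pull
  erw [pull_comp_specMap]
  rw [liftInter, pull_toSpec]
  exact IsLocalization.Away.lift_comp _ _

/-- The transition morphism `φ_{α, β} : U_{α, β} ⟶ U_{β, α}`. -/
def chTrans (α β : Γ) : chInter α β ⟶ chInter β α :=
  liftInter α (changeHom β (chIncl α β) (isUnit_chIncl α β))
    (changeHom_b β α _ _ (by rw [(coeffOf (chIncl α β)).b_self]; exact isUnit_one))

theorem chTrans_chIncl (α β : Γ) : chTrans α β ≫ chIncl β α =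
    changeHom β (chIncl α β) (isUnit_chIncl α β) :=
  liftInter_chIncl _ _ _

theorem isUnit_triple (α β γ : Γ) :
    IsUnit ((coeffOf (pullback.fst (chIncl α β) (chIncl α γ) ≫ chTrans α β ≫ chIncl β α)).b γ) := by
  rw [chTrans_chIncl, comp_changeHom]
  apply changeHom_b
  rw [pullback.condition]
  exact isUnit_coeffOf_comp _ _ (isUnit_chIncl α γ)

/-- The transition morphism on triple intersections. -/
def chTriple (α β γ : Γ) :
    pullback (chIncl α β) (chIncl α γ) ⟶ pullback (chIncl β γ) (chIncl β α) :=
  pullback.lift (liftInter γ (pullback.fst _ _ ≫ chTrans α β ≫ chIncl β α) (isUnit_triple α β γ))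
    (pullback.fst _ _ ≫ chTrans α β) (by rw [liftInter_chIncl, Category.assoc])

theorem chTriple_fst (α β γ : Γ) : chTriple α β γ ≫ pullback.fst _ _ ≫ chIncl β γ =
    changeHom β (pullback.fst (chIncl α β) (chIncl α γ) ≫ chIncl α β)
      (isUnit_coeffOf_comp _ _ (isUnit_chIncl α β)) := by
  rw [← Category.assoc, chTriple, pullback.lift_fst, liftInter_chIncl, chTrans_chIncl,
    comp_changeHom]

theorem changeHom_congr {T : Scheme.{u}} {α β : Γ} {g g' : T ⟶ chAffine α} (e : g = g')
    (h : IsUnit ((coeffOf g).b β)) (h' : IsUnit ((coeffOf g').b β)) :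
    changeHom β g h = changeHom β g' h' := by
  subst e; rfl

theorem chTriple_cocycle (α β γ : Γ) :
    chTriple α β γ ≫ chTriple β γ α ≫ chTriple γ α β = 𝟙 _ := by
  have hm : Mono (pullback.fst (chIncl α β) (chIncl α γ) ≫ chIncl α β) := inferInstance
  rw [← cancel_mono (pullback.fst (chIncl α β) (chIncl α γ) ≫ chIncl α β), Category.id_comp,
    Category.assoc, Category.assoc, chTriple_fst, comp_changeHom, comp_changeHom]
  have e1 : chTriple α β γ ≫ chTriple β γ α ≫ pullback.fst _ _ ≫ chIncl γ α =
      changeHom γ (changeHom β (pullback.fst (chIncl α β) (chIncl α γ) ≫ chIncl α β)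
        (isUnit_coeffOf_comp _ _ (isUnit_chIncl α β)))
        (changeHom_b _ _ _ _ (by
          rw [pullback.condition]
          exact isUnit_coeffOf_comp _ _ (isUnit_chIncl α γ))) := by
    rw [chTriple_fst, comp_changeHom]
    exact changeHom_congr (chTriple_fst α β γ) _ _
  have hγ : IsUnit ((coeffOf (pullback.fst (chIncl α β) (chIncl α γ) ≫ chIncl α β)).b γ) := by
    rw [pullback.condition]
    exact isUnit_coeffOf_comp _ _ (isUnit_chIncl α γ)
  have hα : IsUnit ((coeffOf (pullback.fst (chIncl α β) (chIncl α γ) ≫ chIncl α β)).b α) := by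
    rw [ABCoeff.b_self]
    exact isUnit_one
  rw [changeHom_changeHom β γ _ _ _ hγ] at e1
  rw [changeHom_congr e1 _ (changeHom_b _ _ _ _ hα), changeHom_changeHom γ α _ _ _ hα,
    changeHom_self]

instance (α : Γ) : IsIso (chIncl α α) := by
  have h : IsUnit ((coeffOf (𝟙 (chAffine α))).b α) := by
    rw [ABCoeff.b_self]
    exact isUnit_one
  have : IsSplitEpi (chIncl α α) := ⟨⟨liftInter α (𝟙 _) h, liftInter_chIncl _ _ _⟩⟩
  exact isIso_of_mono_of_isSplitEpi _

variable (Γ) in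
/-- The gluing datum consisting of the schemes `Ch_2(Γ)_{u/𝔽₂, α}`, the open subschemes
`U_{α, β}` and the isomorphisms `φ_{α, β}`. -/
def chGlue : Scheme.GlueData.{u} where
  J := Γ
  U α := chAffine α
  V p := chInter p.1 p.2
  f α β := chIncl α β
  f_id α := inferInstance
  t α β := chTrans α β
  t_id α := by
    rw [← cancel_mono (chIncl α α), chTrans_chIncl, changeHom_self, Category.id_comp]
  t' α β γ := chTriple α β γ
  t_fac α β γ := pullback.lift_snd _ _ _
  cocycle α β γ := chTriple_cocycle α β γ
  f_open α β := inferInstance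

variable (Γ) in
/-- The scheme `Ch_2(Γ)_{u/𝔽₂}`. -/
def chScheme : Scheme.{u} := (chGlue Γ).glued

/-- The open immersion `Ch_2(Γ)_{u/𝔽₂, α} ⟶ Ch_2(Γ)_{u/𝔽₂}`. -/
def chι (α : Γ) : chAffine α ⟶ chScheme Γ := (chGlue Γ).ι α

theorem chι_glue (α β : Γ) :
    chTrans α β ≫ chIncl β α ≫ chι β = chIncl α β ≫ chι α :=
  (chGlue Γ).glue_condition α β

theorem comp_chι {T : Scheme.{u}} {α : Γ} (β : Γ) (g : T ⟶ chAffine α)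
    (h : IsUnit ((coeffOf g).b β)) : g ≫ chι α = changeHom β g h ≫ chι β := by
  have e1 : g ≫ chι α = liftInter β g h ≫ chIncl α β ≫ chι α :=
    (congrArg (· ≫ chι α) (liftInter_chIncl β g h)).symm.trans (Category.assoc _ _ _)
  have e2 : liftInter β g h ≫ chTrans α β ≫ chIncl β α = changeHom β g h :=
    (congrArg (fun k => liftInter β g h ≫ k) (chTrans_chIncl α β)).trans
      ((comp_changeHom β _ _ _).trans (changeHom_congr (liftInter_chIncl β g h) _ _))
  rw [e1, ← chι_glue, ← e2, Category.assoc, Category.assoc]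

variable (Γ) in
/-- `Ch_2(Γ)_{u/𝔽₂}` as a scheme over `𝔽₂`. -/
def ch : Over baseScheme.{u} :=
  Over.mk (Y := chScheme Γ) ((chGlue Γ).openCover.glueMorphisms
    (fun α : Γ => (Spec.map (CommRingCat.ofHom (ChRing.base α)) : chAffine α ⟶ baseScheme))
    (fun _ _ => baseScheme_hom_ext _ _))

/-! ### The morphism `π` -/

variable (Γ) in
/-- `Rep_2(Γ)_{u/𝔽₂}` as a scheme over `𝔽₂`. -/
def rep : Over baseScheme.{u} :=
  Over.mk (Y := (repOpens Γ).toScheme)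
    ((repOpens Γ).ι ≫ Spec.map (CommRingCat.ofHom (UnipRing.base Γ)))

/-- The open subscheme `Rep_2(Γ)_{u/𝔽₂, α}` of `Rep_2(Γ)_{u/𝔽₂}`. -/
def repAt (α : Γ) : (rep Γ).left.Opens := (repOpens Γ).ι ⁻¹ᵁ repOpensAt α

/-- The inclusion of `Rep_2(Γ)_{u/𝔽₂}` in the closed subscheme `repLe Γ` of `Rep_2(Γ)_{𝔽₂}`. -/
def repIncl : (rep Γ).left ⟶ repLe Γ := (repOpens Γ).ι

/-- The representation on `T` given by a morphism `T ⟶ repLe Γ`. -/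
def repOf {T : Scheme.{u}} (h : T ⟶ repLe Γ) : TraceZeroRep Γ Γ(T, ⊤) :=
  (repLeRep Γ).map h.appTop.hom

theorem preimage_repOpensAt {T : Scheme.{u}} (h : T ⟶ repLe Γ) (α : Γ) :
    h ⁻¹ᵁ repOpensAt α = offDiag ((repOf h).rep α) := by
  rw [repOpensAt_eq, preimage_offDiag]
  rfl

theorem two_of_repLe {T : Scheme.{u}} (h : T ⟶ repLe Γ) : (2 : Γ(T, ⊤)) = 0 := by
  have := congrArg h.appTop.hom (repLe_two Γ)
  rwa [map_ofNat, map_zero] at this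

def baseOfRep {T : Scheme.{u}} (h : T ⟶ repLe Γ) : F2.{u} →+* Γ(T, ⊤) :=
  (pull (R := UnipRing Γ) h).comp (UnipRing.base Γ)

theorem offDiag_repAt (α : Γ) :
    offDiag ((repOf ((repAt α).ι ≫ repIncl)).rep α) = ⊤ := by
  rw [← preimage_repOpensAt]
  exact (repAt α).ι_preimage_self

/-- The morphism `π_α : Rep_2(Γ)_{u/𝔽₂, α} ⟶ Ch_2(Γ)_{u/𝔽₂, α}` classifying the
`(a, b)`-coefficients of the universal representation with respect to `α`. -/
def quotientMapAt (α : Γ) : (repAt α).toScheme ⟶ chAffine α :=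
  ofCoeff (baseOfRep ((repAt α).ι ≫ repIncl))
    ((repOf ((repAt α).ι ≫ repIncl)).coeff (two_of_repLe ((repAt α).ι ≫ repIncl)) α
      (offDiag_repAt α))

variable (Γ) in
theorem isOpenCover_repAt : TopologicalSpace.IsOpenCover (repAt (Γ := Γ)) := by
  rw [TopologicalSpace.IsOpenCover, eq_top_iff]
  intro x _
  have hx : (repOpens Γ).ι x ∈ repOpens Γ := x.2
  have hx' : (repOpens Γ).ι x ∈ ⨆ γ : Γ, repOpensAt γ := repOpens_eq Γ ▸ hx
  rw [TopologicalSpace.Opens.mem_iSup] at hx' ⊢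
  exact hx'

theorem quotientMapAt_compat {T : Scheme.{u}} (α β : Γ) (p : T ⟶ (repAt α).toScheme)
    (q : T ⟶ (repAt β).toScheme) (hpq : p ≫ (repAt α).ι = q ≫ (repAt β).ι) :
    p ≫ quotientMapAt α ≫ chι α = q ≫ quotientMapAt β ≫ chι β := by
  have hp : p ≫ (repAt α).ι ≫ repIncl = q ≫ (repAt β).ι ≫ repIncl := by
    rw [← Category.assoc, hpq, Category.assoc]
  let h := p ≫ (repAt α).ι ≫ repIncl
  have h2 := two_of_repLe h
  have hα : offDiag ((repOf h).rep α) = ⊤ := by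
    rw [← preimage_repOpensAt]
    change p ⁻¹ᵁ (((repAt α).ι ≫ repIncl) ⁻¹ᵁ repOpensAt α) = ⊤
    rw [preimage_repOpensAt, offDiag_repAt]
    rfl
  have hβ : offDiag ((repOf h).rep β) = ⊤ := by
    rw [← preimage_repOpensAt]
    change (p ≫ (repAt α).ι ≫ repIncl) ⁻¹ᵁ repOpensAt β = ⊤
    rw [hp]
    change q ⁻¹ᵁ (((repAt β).ι ≫ repIncl) ⁻¹ᵁ repOpensAt β) = ⊤
    rw [preimage_repOpensAt, offDiag_repAt]
    rfl
  have key : ∀ (δ : Γ) (r : T ⟶ (repAt δ).toScheme) (hr : r ≫ (repAt δ).ι ≫ repIncl = h)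
      (hδ : offDiag ((repOf h).rep δ) = ⊤),
      coeffOf (r ≫ quotientMapAt δ) = (repOf h).coeff h2 δ hδ := by
    intro δ r hr hδ
    have e : (repOf ((repAt δ).ι ≫ repIncl)).map r.appTop.hom = repOf h := by
      rw [← hr, repOf, repOf, Scheme.Hom.comp_appTop r]
      rfl
    rw [coeffOf_comp, quotientMapAt, coeffOf_ofCoeff]
    have hδ' : offDiag (((repOf ((repAt δ).ι ≫ repIncl)).map r.appTop.hom).rep δ) = ⊤ := by
      rw [e]; exact hδ
    rw [TraceZeroRep.coeff_map r _ h2 _ _ _ hδ']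
    congr 1
  have kα := key α p rfl hα
  have kβ := key β q hp.symm hβ
  obtain ⟨hv, hch⟩ := (repOf h).coeff_change h2 α β hα hβ
  have hu : IsUnit ((coeffOf (p ≫ quotientMapAt α)).b β) := by
    rw [kα]
    exact IsUnit.of_mul_eq_one _ hv
  rw [← Category.assoc, comp_chι β _ hu, ← Category.assoc]
  congr 1
  apply coeffOf_injective
  rw [kβ, hch]
  have hv' : (coeffOf (p ≫ quotientMapAt α)).b β * ((repOf h).coeff h2 β hβ).b α = 1 := by
    rw [kα]; exact hv
  rw [coeffOf_changeHom β _ hu h2 _ hv']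
  congr 1

variable (Γ) in
/-- The open cover of `Rep_2(Γ)_{u/𝔽₂}` by the `Rep_2(Γ)_{u/𝔽₂, α}`. -/
def repCover : (rep Γ).left.OpenCover :=
  (rep Γ).left.openCoverOfIsOpenCover repAt (isOpenCover_repAt Γ)

variable (Γ) in
/-- The morphism of schemes underlying `π`, glued from the `π_α`. -/
def quotientMapLeft : (rep Γ).left ⟶ chScheme Γ :=
  (repCover Γ).glueMorphisms
    (fun α : Γ => quotientMapAt α ≫ chι α)
    (fun α β : Γ => quotientMapAt_compat α β _ _ pullback.condition)

variable (Γ) in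
/-- The morphism `π : Rep_2(Γ)_{u/𝔽₂} ⟶ Ch_2(Γ)_{u/𝔽₂}`. -/
def quotientMap : rep Γ ⟶ ch Γ :=
  Over.homMk (quotientMapLeft Γ) (baseScheme_hom_ext _ _)

theorem repAt_quotientMap (α : Γ) :
    (repCover Γ).f α ≫ quotientMapLeft Γ = quotientMapAt α ≫ chι α := by
  unfold quotientMapLeft
  exact Scheme.Cover.ι_glueMorphisms (repCover Γ) (fun α : Γ => quotientMapAt α ≫ chι α) _ α

end Gluing

section ProjectiveGroup

/-! ### The group scheme `PGL₂` -/

section Aut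

variable {B : Type v} [CommRing B] {C : Type w} [CommRing C]

/-- The `B`-linear endomorphism of `M₂(B)` given by a `4 × 4` matrix. -/
def linAct (T : Matrix (Fin 2 × Fin 2) (Fin 2 × Fin 2) B) :
    Matrix (Fin 2) (Fin 2) B →ₗ[B] Matrix (Fin 2) (Fin 2) B where
  toFun x := Matrix.of fun i j => ∑ k, T (i, j) k * x k.1 k.2
  map_add' x y := by
    ext i j
    simp [mul_add, Finset.sum_add_distrib]
  map_smul' c x := by
    ext i j
    simp only [Matrix.of_apply, Matrix.smul_apply, smul_eq_mul, RingHom.id_apply, Finset.mul_sum]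
    exact Finset.sum_congr rfl fun k _ => by ring

theorem linAct_apply (T : Matrix (Fin 2 × Fin 2) (Fin 2 × Fin 2) B)
    (x : Matrix (Fin 2) (Fin 2) B) (i j : Fin 2) :
    linAct T x i j = ∑ k, T (i, j) k * x k.1 k.2 := rfl

theorem linAct_map (f : B →+* C) (T : Matrix (Fin 2 × Fin 2) (Fin 2 × Fin 2) B)
    (x : Matrix (Fin 2) (Fin 2) B) : linAct (T.map f) (x.map f) = (linAct T x).map f := by
  ext i j
  simp [linAct_apply]

theorem linAct_one (x : Matrix (Fin 2) (Fin 2) B) : linAct 1 x = x := by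
  ext i j
  simp [linAct_apply, Matrix.one_apply]

theorem linAct_mul (T S : Matrix (Fin 2 × Fin 2) (Fin 2 × Fin 2) B)
    (x : Matrix (Fin 2) (Fin 2) B) : linAct (T * S) x = linAct T (linAct S x) := by
  ext i j
  simp only [linAct_apply, Matrix.mul_apply, Finset.sum_mul, Finset.mul_sum]
  rw [Finset.sum_comm]
  exact Finset.sum_congr rfl fun k _ => Finset.sum_congr rfl fun l _ => by ring

/-- The matrix unit `E_p`. -/
def matUnit (B : Type v) [CommRing B] (p : Fin 2 × Fin 2) : Matrix (Fin 2) (Fin 2) B :=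
  Matrix.single p.1 p.2 1

theorem matUnit_map (f : B →+* C) (p : Fin 2 × Fin 2) : (matUnit B p).map f = matUnit C p := by
  simp [matUnit]

/-- The linear endomorphism of `M₂(B)` given by `T` respects the unit and the products of matrix
units, hence is an endomorphism of `B`-algebras. -/
structure IsAlgMatrix (T : Matrix (Fin 2 × Fin 2) (Fin 2 × Fin 2) B) : Prop where
  unit : linAct T 1 = 1
  mul_unit : ∀ p q, linAct T (matUnit B p * matUnit B q) =
    linAct T (matUnit B p) * linAct T (matUnit B q)

theorem eq_sum_matUnit (x : Matrix (Fin 2) (Fin 2) B) :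
    x = ∑ p : Fin 2 × Fin 2, x p.1 p.2 • matUnit B p := by
  conv_lhs => rw [Matrix.matrix_eq_sum_single x]
  rw [Fintype.sum_prod_type]
  simp [matUnit]

theorem IsAlgMatrix.mul {T : Matrix (Fin 2 × Fin 2) (Fin 2 × Fin 2) B} (h : IsAlgMatrix T)
    (x y : Matrix (Fin 2) (Fin 2) B) : linAct T (x * y) = linAct T x * linAct T y := by
  rw [eq_sum_matUnit x, eq_sum_matUnit y]
  simp only [Finset.sum_mul_sum, map_sum, smul_mul_smul_comm, map_smul, h.mul_unit]

theorem IsAlgMatrix.map {T : Matrix (Fin 2 × Fin 2) (Fin 2 × Fin 2) B} (h : IsAlgMatrix T)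
    (f : B →+* C) : IsAlgMatrix (T.map f) where
  unit := by
    have := linAct_map f T 1
    rw [h.unit] at this
    simpa using this
  mul_unit p q := by
    have e (x y : Matrix (Fin 2) (Fin 2) B) : (x * y).map f = x.map f * y.map f :=
      Matrix.map_mul
    rw [← matUnit_map f, ← matUnit_map f, ← e, linAct_map, linAct_map, linAct_map, h.mul_unit, e]

variable (B) in
/-- The group of automorphisms of the `B`-algebra `M₂(B)`, as a group of invertible `4 × 4`
matrices. -/
def AutM2 : Subgroup (GL (Fin 2 × Fin 2) B) where
  carrier := {g | IsAlgMatrix g.val}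
  one_mem' := ⟨linAct_one _, fun p q => by simp [linAct_one]⟩
  mul_mem' {g h} hg hh := by
    refine ⟨?_, fun p q => ?_⟩
    · rw [Units.val_mul, linAct_mul, hh.unit, hg.unit]
    · simp only [Units.val_mul, linAct_mul, hh.mul, hg.mul]
  inv_mem' {g} hg := by
    have e (x : Matrix (Fin 2) (Fin 2) B) : linAct (g⁻¹).val (linAct g.val x) = x := by
      rw [← linAct_mul, ← Units.val_mul, inv_mul_cancel, Units.val_one, linAct_one]
    have e' (x : Matrix (Fin 2) (Fin 2) B) : linAct g.val (linAct (g⁻¹).val x) = x := by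
      rw [← linAct_mul, ← Units.val_mul, mul_inv_cancel, Units.val_one, linAct_one]
    have inj : Function.Injective (linAct g.val) := Function.LeftInverse.injective e
    refine ⟨?_, fun p q => ?_⟩
    · apply inj
      rw [e', hg.unit]
    · apply inj
      rw [e', hg.mul, e', e']

namespace AutM2

/-- The algebra automorphism given by an element of `AutM2 B`. -/
def toAlgEquiv : AutM2 B →* (Matrix (Fin 2) (Fin 2) B ≃ₐ[B] Matrix (Fin 2) (Fin 2) B) where
  toFun g := AlgEquiv.ofLinearEquiv
    (LinearEquiv.ofLinearMap (linAct g.1.val) (linAct (g⁻¹).1.val)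
      (LinearMap.ext fun x => by
        change linAct g.1.val (linAct (g⁻¹).1.val x) = x
        rw [← linAct_mul, ← Units.val_mul, ← Subgroup.coe_mul, mul_inv_cancel, Subgroup.coe_one,
          Units.val_one, linAct_one])
      (LinearMap.ext fun x => by
        change linAct (g⁻¹).1.val (linAct g.1.val x) = x
        rw [← linAct_mul, ← Units.val_mul, ← Subgroup.coe_mul, inv_mul_cancel, Subgroup.coe_one,
          Units.val_one, linAct_one]))
    g.2.unit g.2.mul
  map_one' := AlgEquiv.ext fun x => linAct_one x
  map_mul' g h := AlgEquiv.ext fun x => linAct_mul _ _ x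

theorem toAlgEquiv_apply (g : AutM2 B) (x : Matrix (Fin 2) (Fin 2) B) :
    toAlgEquiv g x = linAct g.1.val x := rfl

/-- Every automorphism of the algebra `M₂(B)` comes from a unique element of `AutM2 B`. -/
theorem toAlgEquiv_bijective : Function.Bijective (toAlgEquiv (B := B)) := by
  have key (φ : Matrix (Fin 2) (Fin 2) B →ₗ[B] Matrix (Fin 2) (Fin 2) B)
      (x : Matrix (Fin 2) (Fin 2) B) :
      linAct (Matrix.of fun (p q : Fin 2 × Fin 2) => φ (matUnit B q) p.1 p.2) x = φ x := by
    conv_rhs => rw [eq_sum_matUnit x, map_sum]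
    ext i j
    simp [linAct_apply, Matrix.sum_apply, mul_comm]
  have inj (T S : Matrix (Fin 2 × Fin 2) (Fin 2 × Fin 2) B)
      (h : ∀ x, linAct T x = linAct S x) : T = S := by
    ext p q
    have := congrFun (congrFun (h (matUnit B q)) p.1) p.2
    rw [linAct_apply, linAct_apply] at this
    have hq (k : Fin 2 × Fin 2) : matUnit B q k.1 k.2 = if k = q then 1 else 0 := by
      rw [matUnit, Matrix.single_apply]
      refine if_congr ?_ rfl rfl
      rw [Prod.ext_iff, eq_comm, eq_comm (a := q.2)]
    simpa [hq] using this
  constructor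
  · intro g h e
    apply Subtype.ext
    apply Units.ext
    exact inj _ _ fun x => DFunLike.congr_fun e x
  · intro φ
    let T := Matrix.of fun (p q : Fin 2 × Fin 2) => φ (matUnit B q) p.1 p.2
    let S := Matrix.of fun (p q : Fin 2 × Fin 2) => φ.symm (matUnit B q) p.1 p.2
    have hT (x) : linAct T x = φ x := key φ.toLinearMap x
    have hS (x) : linAct S x = φ.symm x := key φ.symm.toLinearMap x
    refine ⟨⟨⟨T, S, ?_, ?_⟩, ?_, ?_⟩, ?_⟩
    · apply inj
      intro x
      rw [linAct_mul, hT, hS, linAct_one, AlgEquiv.apply_symm_apply]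
    · apply inj
      intro x
      rw [linAct_mul, hT, hS, linAct_one, AlgEquiv.symm_apply_apply]
    · exact (hT 1).trans (map_one φ)
    · intro p q
      exact (hT _).trans ((map_mul φ _ _).trans (congrArg₂ _ (hT _).symm (hT _).symm))
    · exact AlgEquiv.ext hT

/-- Extension of scalars. -/
def map (f : B →+* C) : AutM2 B →* AutM2 C where
  toFun g := ⟨Matrix.GeneralLinearGroup.map f g.1, g.2.map f⟩
  map_one' := by
    apply Subtype.ext
    simp
  map_mul' g h := by
    apply Subtype.ext
    simp

theorem map_val (f : B →+* C) (g : AutM2 B) : (map f g).1.val = g.1.val.map f := rfl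

theorem ext' {g h : AutM2 B} (e : ∀ p q, g.1.val p q = h.1.val p q) : g = h :=
  Subtype.ext (Units.ext (Matrix.ext e))

theorem toAlgEquiv_map (f : B →+* C) (g : AutM2 B) (x : Matrix (Fin 2) (Fin 2) B) :
    toAlgEquiv (map f g) (x.map f) = (toAlgEquiv g x).map f :=
  linAct_map f _ _

/-- An algebra automorphism of `M₂(B)` multiplies the trace by a constant. -/
theorem trace_toAlgEquiv (g : AutM2 B) (x : Matrix (Fin 2) (Fin 2) B) :
    (toAlgEquiv g x).trace = (toAlgEquiv g (matUnit B (0, 0))).trace * x.trace := by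
  have comm (p q : Fin 2 × Fin 2) : (toAlgEquiv g (matUnit B p * matUnit B q)).trace =
      (toAlgEquiv g (matUnit B q * matUnit B p)).trace := by
    rw [map_mul, map_mul, Matrix.trace_mul_comm]
  have h01 : (toAlgEquiv g (matUnit B (0, 1))).trace = 0 := by
    have := comm (0, 0) (0, 1)
    simpa [matUnit] using this
  have h10 : (toAlgEquiv g (matUnit B (1, 0))).trace = 0 := by
    have := comm (1, 0) (0, 0)
    simpa [matUnit] using this
  have h11 : (toAlgEquiv g (matUnit B (1, 1))).trace =
      (toAlgEquiv g (matUnit B (0, 0))).trace := by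
    have := comm (1, 0) (0, 1)
    simpa [matUnit] using this
  conv_lhs => rw [eq_sum_matUnit x]
  simp only [Fintype.sum_prod_type, Fin.sum_univ_two, map_add, map_smul, Matrix.trace_add,
    Matrix.trace_smul, h01, h10, h11, Matrix.trace_fin_two x, smul_eq_mul]
  ring

end AutM2

end Aut

/-- The indeterminates `t` (for `true`) and `s` (for `false`), arranged in `4 × 4` matrices. -/
def pglMatrix (b : Bool) : Matrix (Fin 2 × Fin 2) (Fin 2 × Fin 2)
    (MvPolynomial (Bool × (Fin 2 × Fin 2) × (Fin 2 × Fin 2)) F2.{u}) :=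
  Matrix.of fun p q => MvPolynomial.X (b, p, q)

/-- The equations which express that `s` is inverse to `t` and that `t` defines an endomorphism
of the algebra of `2 × 2` matrices. -/
def pglRelations : Set (MvPolynomial (Bool × (Fin 2 × Fin 2) × (Fin 2 × Fin 2)) F2.{u}) :=
  {x | ∃ p q, x = (pglMatrix true * pglMatrix false - 1) p q} ∪
  {x | ∃ p q, x = (pglMatrix false * pglMatrix true - 1) p q} ∪
  {x | ∃ i j, x = (linAct (pglMatrix true) 1 - 1) i j} ∪
  {x | ∃ p q i j, x = (linAct (pglMatrix true) (matUnit _ p * matUnit _ q) -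
    linAct (pglMatrix true) (matUnit _ p) * linAct (pglMatrix true) (matUnit _ q)) i j}

/-- The coordinate ring of `PGL₂ ⊗ 𝔽₂`. -/
def PGLRing : Type u :=
  MvPolynomial (Bool × (Fin 2 × Fin 2) × (Fin 2 × Fin 2)) F2.{u} ⧸ Ideal.span pglRelations.{u}

namespace PGLRing

instance : CommRing PGLRing.{u} :=
  inferInstanceAs (CommRing (MvPolynomial (Bool × (Fin 2 × Fin 2) × (Fin 2 × Fin 2)) F2.{u} ⧸
    Ideal.span pglRelations.{u}))

def mk : MvPolynomial (Bool × (Fin 2 × Fin 2) × (Fin 2 × Fin 2)) F2.{u} →+* PGLRing.{u} :=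
  Ideal.Quotient.mk _

def base : F2.{u} →+* PGLRing.{u} := mk.comp MvPolynomial.C

theorem mk_eq_zero {x : MvPolynomial (Bool × (Fin 2 × Fin 2) × (Fin 2 × Fin 2)) F2.{u}}
    (hx : x ∈ pglRelations.{u}) : mk x = 0 :=
  Ideal.Quotient.eq_zero_iff_mem.2 (Ideal.subset_span hx)

/-- The universal automorphism of the algebra of `2 × 2` matrices. -/
def universal : AutM2 PGLRing.{u} := by
  have e (x y : Matrix (Fin 2 × Fin 2) (Fin 2 × Fin 2)
      (MvPolynomial (Bool × (Fin 2 × Fin 2) × (Fin 2 × Fin 2)) F2.{u})) :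
      (x * y).map mk = x.map mk * y.map mk := Matrix.map_mul
  have e' (x y : Matrix (Fin 2) (Fin 2)
      (MvPolynomial (Bool × (Fin 2 × Fin 2) × (Fin 2 × Fin 2)) F2.{u})) :
      (x * y).map mk = x.map mk * y.map mk := Matrix.map_mul
  have h1 : (1 : Matrix (Fin 2) (Fin 2)
      (MvPolynomial (Bool × (Fin 2 × Fin 2) × (Fin 2 × Fin 2)) F2.{u})).map mk = 1 := by simp
  have h1' : (1 : Matrix (Fin 2 × Fin 2) (Fin 2 × Fin 2)
      (MvPolynomial (Bool × (Fin 2 × Fin 2) × (Fin 2 × Fin 2)) F2.{u})).map mk = 1 := by simp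
  have hmk (x y : MvPolynomial (Bool × (Fin 2 × Fin 2) × (Fin 2 × Fin 2)) F2.{u})
      (h : mk (x - y) = 0) : mk x = mk y := by
    rwa [map_sub, sub_eq_zero] at h
  refine ⟨⟨(pglMatrix true).map mk, (pglMatrix false).map mk, ?_, ?_⟩, ?_, ?_⟩
  · rw [← e, ← h1']
    ext p q
    exact hmk _ _ (mk_eq_zero (Or.inl (Or.inl (Or.inl ⟨p, q, rfl⟩))))
  · rw [← e, ← h1']
    ext p q
    exact hmk _ _ (mk_eq_zero (Or.inl (Or.inl (Or.inr ⟨p, q, rfl⟩))))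
  · change linAct ((pglMatrix true).map mk) 1 = 1
    rw [← h1, linAct_map]
    ext i j
    exact hmk _ _ (mk_eq_zero (Or.inl (Or.inr ⟨i, j, rfl⟩)))
  · intro p q
    change linAct ((pglMatrix true).map mk) _ = linAct ((pglMatrix true).map mk) _ *
      linAct ((pglMatrix true).map mk) _
    rw [← matUnit_map mk, ← matUnit_map mk, ← e', linAct_map, linAct_map, linAct_map, ← e']
    ext i j
    exact hmk _ _ (mk_eq_zero (Or.inr ⟨p, q, i, j, rfl⟩))

theorem hom_ext {R : Type v} [CommRing R] {f g : PGLRing.{u} →+* R}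
    (h : AutM2.map f universal = AutM2.map g universal) : f = g := by
  apply Ideal.Quotient.ringHom_ext
  apply MvPolynomial.ringHom_ext'
  · exact F2.subsingleton_hom _ _
  · rintro ⟨_ | _, p, q⟩
    · have := congrArg (fun k => (k⁻¹).1.val p q) h
      exact this
    · have := congrArg (fun k => k.1.val p q) h
      exact this

/-- The homomorphism that classifies an automorphism of the algebra of `2 × 2` matrices. -/
def lift {R : Type v} [CommRing R] (c : F2.{u} →+* R) (g : AutM2 R) : PGLRing.{u} →+* R :=
  Ideal.Quotient.lift _ (MvPolynomial.eval₂Hom c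
      fun x => if x.1 then g.1.val x.2.1 x.2.2 else (g⁻¹).1.val x.2.1 x.2.2) (by
    set F := MvPolynomial.eval₂Hom c
      fun x : Bool × (Fin 2 × Fin 2) × (Fin 2 × Fin 2) =>
        if x.1 then g.1.val x.2.1 x.2.2 else (g⁻¹).1.val x.2.1 x.2.2 with hF
    have ht : (pglMatrix true).map F = g.1.val := by
      ext p q
      simp [pglMatrix, hF]
    have hs : (pglMatrix false).map F = (g⁻¹).1.val := by
      ext p q
      simp [pglMatrix, hF]
    have e (x y : Matrix (Fin 2 × Fin 2) (Fin 2 × Fin 2)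
        (MvPolynomial (Bool × (Fin 2 × Fin 2) × (Fin 2 × Fin 2)) F2.{u})) :
        (x * y).map F = x.map F * y.map F := Matrix.map_mul
    have e' (x y : Matrix (Fin 2) (Fin 2)
        (MvPolynomial (Bool × (Fin 2 × Fin 2) × (Fin 2 × Fin 2)) F2.{u})) :
        (x * y).map F = x.map F * y.map F := Matrix.map_mul
    have h1 : (1 : Matrix (Fin 2) (Fin 2)
      (MvPolynomial (Bool × (Fin 2 × Fin 2) × (Fin 2 × Fin 2)) F2.{u})).map F = 1 := by simp
    have h1' : (1 : Matrix (Fin 2 × Fin 2) (Fin 2 × Fin 2)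
      (MvPolynomial (Bool × (Fin 2 × Fin 2) × (Fin 2 × Fin 2)) F2.{u})).map F = 1 := by simp
    intro x hx
    rw [← RingHom.mem_ker]
    refine (Ideal.span_le (I := RingHom.ker F)).2 ?_ hx
    rintro x (((⟨p, q, rfl⟩ | ⟨p, q, rfl⟩) | ⟨i, j, rfl⟩) | ⟨p, q, i, j, rfl⟩) <;>
      rw [SetLike.mem_coe, RingHom.mem_ker, Matrix.sub_apply, map_sub, sub_eq_zero]
    · have : (pglMatrix true * pglMatrix false).map F = (1 : Matrix _ _ _).map F := by
        rw [e, ht, hs, h1', ← Units.val_mul, ← Subgroup.coe_mul, mul_inv_cancel,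
          Subgroup.coe_one, Units.val_one]
      exact congrFun (congrFun this p) q
    · have : (pglMatrix false * pglMatrix true).map F = (1 : Matrix _ _ _).map F := by
        rw [e, ht, hs, h1', ← Units.val_mul, ← Subgroup.coe_mul, inv_mul_cancel,
          Subgroup.coe_one, Units.val_one]
      exact congrFun (congrFun this p) q
    · have : (linAct (pglMatrix true) 1).map F = (1 : Matrix _ _ _).map F := by
        rw [← linAct_map, ht, h1, g.2.unit]
      exact congrFun (congrFun this i) j
    · have : (linAct (pglMatrix true) (matUnit _ p * matUnit _ q)).map F =
          (linAct (pglMatrix true) (matUnit _ p) * linAct (pglMatrix true) (matUnit _ q)).map F := by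
        rw [← linAct_map, e', e', ← linAct_map, ← linAct_map, ht, g.2.mul]
      exact congrFun (congrFun this i) j)

@[simp] theorem map_lift {R : Type v} [CommRing R] (c : F2.{u} →+* R) (g : AutM2 R) :
    AutM2.map (lift c g) universal = g := by
  apply AutM2.ext'
  intro p q
  change MvPolynomial.eval₂Hom c _ (MvPolynomial.X (true, p, q)) = _
  simp

end PGLRing

/-- The functor that sends a scheme `T` over `𝔽₂` to the group of automorphisms of the algebra of
`2 × 2` matrices over the ring of global sections of `T`. -/
def autFunctor : (Over baseScheme.{u})ᵒᵖ ⥤ GrpCat.{u} where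
  obj T := GrpCat.of (AutM2 Γ(T.unop.left, ⊤))
  map f := GrpCat.ofHom (AutM2.map f.unop.left.appTop.hom)
  map_id T := GrpCat.hom_ext (MonoidHom.ext fun g => AutM2.ext' fun p q => by
    change (Scheme.Hom.appTop (𝟙 T.unop.left)).hom (g.1.val p q) = g.1.val p q
    rw [Scheme.Hom.id_appTop]
    rfl)
  map_comp {T₁ T₂ T₃} f g := GrpCat.hom_ext (MonoidHom.ext fun k => AutM2.ext' fun p q => by
    change (Scheme.Hom.appTop (g.unop.left ≫ f.unop.left)).hom (k.1.val p q) = _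
    rw [Scheme.Hom.comp_appTop]
    rfl)

/-- `PGL₂ ⊗ 𝔽₂` as a scheme over `𝔽₂`. -/
def pgl : Over baseScheme.{u} :=
  Over.mk (Y := Spec (CommRingCat.of PGLRing.{u})) (Spec.map (CommRingCat.ofHom PGLRing.base))

/-- Sections over an `𝔽₂`-scheme have a canonical `𝔽₂`-structure. -/
def baseOfOver (T : Over baseScheme.{u}) : F2.{u} →+* Γ(T.left, ⊤) := pull T.hom

/-- Morphisms `T ⟶ PGL₂ ⊗ 𝔽₂` are automorphisms of the algebra of `2 × 2` matrices. -/
def pglPoint {T : Over baseScheme.{u}} :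
    (T ⟶ pgl.{u}) ≃ AutM2 Γ(T.left, ⊤) where
  toFun f := AutM2.map (pull (R := PGLRing.{u}) f.left) PGLRing.universal
  invFun g := Over.homMk (toSpec (PGLRing.lift (baseOfOver T) g)) (baseScheme_hom_ext _ _)
  left_inv f := by
    apply Over.OverMorphism.ext
    refine hom_ext_of_pull (R := PGLRing.{u}) (PGLRing.hom_ext ?_)
    refine Eq.trans ?_ (PGLRing.map_lift (baseOfOver T) _)
    exact congrArg (fun k => AutM2.map k PGLRing.universal) (pull_toSpec _)
  right_inv g := by
    refine Eq.trans ?_ (PGLRing.map_lift (baseOfOver T) _)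
    exact congrArg (fun k => AutM2.map k PGLRing.universal) (pull_toSpec _)

theorem pglPoint_comp {T T' : Over baseScheme.{u}} (h : T' ⟶ T) (f : T ⟶ pgl.{u}) :
    pglPoint (h ≫ f) = AutM2.map h.left.appTop.hom (pglPoint f) := by
  exact congrArg (fun k => AutM2.map k PGLRing.universal)
    (pull_comp (R := PGLRing.{u}) h.left f.left)

/-- The functor of points of `PGL₂ ⊗ 𝔽₂`. -/
def pglRepresentable : (autFunctor.{u} ⋙ forget GrpCat).RepresentableBy pgl.{u} where
  homEquiv := pglPoint
  homEquiv_comp h f := pglPoint_comp h f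

instance : GrpObj pgl.{u} := GrpObj.ofRepresentableBy _ autFunctor pglRepresentable

end ProjectiveGroup

section Quotients

variable {Γ : Type u} [Monoid Γ]

/-! ### The action of `PGL₂` on representations -/

theorem det_linAct_eq_zero {R : Type v} [CommRing R]
    (T : Matrix (Fin 2 × Fin 2) (Fin 2 × Fin 2) R) (M : Fin 3 → Matrix (Fin 2) (Fin 2) R)
    (h : ∀ r : Fin 3 → Fin 2 × Fin 2, (Matrix.of fun i j => M j (r i).1 (r i).2).det = 0)
    (r : Fin 3 → Fin 2 × Fin 2) :
    (Matrix.of fun i j => linAct T (M j) (r i).1 (r i).2).det = 0 := by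
  have e : (Matrix.of fun i j => linAct T (M j) (r i).1 (r i).2) =
      (fun i => ∑ k : Fin 2 × Fin 2, T (r i) k • fun j => M j k.1 k.2) := by
    ext i j
    simp [linAct_apply]
  have := (Matrix.detRowAlternating (n := Fin 3) (R := R)).toMultilinearMap.map_sum
    (fun i (k : Fin 2 × Fin 2) => T (r i) k • fun j : Fin 3 => M j k.1 k.2)
  rw [e]
  refine this.trans (Finset.sum_eq_zero fun f _ => ?_)
  rw [MultilinearMap.map_smul_univ]
  have h' := h f
  change _ • Matrix.det (Matrix.of fun i j => M j (f i).1 (f i).2) = 0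
  rw [h', smul_zero]

/-- The right action of automorphisms of the algebra of `2 × 2` matrices on representations,
`(ρ · g)(γ) = g⁻¹(ρ(γ))`. If `g` is the conjugation `X ↦ P X P⁻¹`, then `ρ · g = P⁻¹ ρ P`. -/
def TraceZeroRep.act {R : Type v} [CommRing R] (P : TraceZeroRep Γ R) (g : AutM2 R) :
    TraceZeroRep Γ R where
  rep := ((AutM2.toAlgEquiv g⁻¹ : Matrix (Fin 2) (Fin 2) R →* Matrix (Fin 2) (Fin 2) R)).comp P.rep
  trace_eq_zero γ := by
    change (AutM2.toAlgEquiv g⁻¹ (P.rep γ)).trace = 0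
    rw [AutM2.trace_toAlgEquiv, P.trace_eq_zero, mul_zero]
  minor_eq_zero m := det_linAct_eq_zero _ _ (P.minor_eq_zero m)

theorem TraceZeroRep.act_rep {R : Type v} [CommRing R] (P : TraceZeroRep Γ R) (g : AutM2 R)
    (γ : Γ) : (P.act g).rep γ = AutM2.toAlgEquiv g⁻¹ (P.rep γ) := rfl

theorem TraceZeroRep.act_one {R : Type v} [CommRing R] (P : TraceZeroRep Γ R) :
    P.act 1 = P :=
  TraceZeroRep.ext' fun γ => by rw [act_rep, inv_one, map_one]; rfl

theorem TraceZeroRep.act_mul {R : Type v} [CommRing R] (P : TraceZeroRep Γ R) (g h : AutM2 R) :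
    P.act (g * h) = (P.act g).act h :=
  TraceZeroRep.ext' fun γ => by
    rw [act_rep, act_rep, act_rep, mul_inv_rev, map_mul]; rfl

theorem TraceZeroRep.act_map {R : Type v} [CommRing R] {R' : Type w} [CommRing R']
    (P : TraceZeroRep Γ R) (g : AutM2 R) (f : R →+* R') :
    (P.act g).map f = (P.map f).act (AutM2.map f g) :=
  TraceZeroRep.ext' fun γ => by
    rw [map_rep, act_rep, act_rep, map_rep, ← map_inv, AutM2.toAlgEquiv_map]

theorem TraceZeroRep.le_offDiag_act {T : Scheme.{u}} (h2 : (2 : Γ(T, ⊤)) = 0)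
    (P : TraceZeroRep Γ Γ(T, ⊤)) (g : AutM2 Γ(T, ⊤)) (γ : Γ) :
    offDiag (P.rep γ) ≤ offDiag ((P.act g).rep γ) := by
  intro x hx
  rw [mem_offDiag] at hx ⊢
  let f := (T.Γevaluation x).hom
  let Q := P.map f
  let k := AutM2.map f g
  have e : evalAt x ((P.act g).rep γ) = (Q.act k).rep γ :=
    congrArg (fun Z => Z.rep γ) (P.act_map g f)
  change Q.rep γ 0 1 ≠ 0 ∨ Q.rep γ 1 0 ≠ 0 at hx
  rw [e]
  by_contra! hcon
  have h11 := apply_eq_of_trace (two_eq_zero_residueField h2 x) ((Q.act k).trace_eq_zero γ)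
  have hsc : (Q.act k).rep γ = (Q.act k).rep γ 0 0 • 1 := by
    ext i j
    fin_cases i <;> fin_cases j <;> simp [hcon.1, hcon.2, h11]
  have hQ : (Q.act k).act k⁻¹ = Q := by
    rw [← TraceZeroRep.act_mul, mul_inv_cancel, TraceZeroRep.act_one]
  have : Q.rep γ = (Q.act k).rep γ 0 0 • 1 := by
    conv_lhs => rw [← hQ, TraceZeroRep.act_rep, hsc, map_smul, map_one]
  rw [this] at hx
  simp at hx

/-! ### The functor of points of `Rep_2(Γ)_{u/𝔽₂}` -/

instance : IsOpenImmersion (repIncl (Γ := Γ)) :=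
  inferInstanceAs (IsOpenImmersion (repOpens Γ).ι)

theorem range_repIncl : Set.range (repIncl (Γ := Γ)) = (repOpens Γ : Set (repLe Γ)) :=
  (repOpens Γ).range_ι

/-- The representation given by a morphism `T ⟶ Rep_2(Γ)_{u/𝔽₂}`. -/
def repPoint {T : Over baseScheme.{u}} (f : T ⟶ rep Γ) : TraceZeroRep Γ Γ(T.left, ⊤) :=
  repOf (f.left ≫ repIncl)

theorem repOf_injective {T : Scheme.{u}} {f g : T ⟶ repLe Γ} (h : repOf f = repOf g) : f = g :=
  hom_ext_of_pull (UnipRing.hom_ext h)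

theorem repPoint_injective {T : Over baseScheme.{u}} {f g : T ⟶ rep Γ}
    (h : repPoint f = repPoint g) : f = g := by
  apply Over.OverMorphism.ext
  have := repOf_injective h
  exact (cancel_mono repIncl).1 this

theorem repPoint_comp {T T' : Over baseScheme.{u}} (h : T' ⟶ T) (f : T ⟶ rep Γ) :
    repPoint (h ≫ f) = (repPoint f).map h.left.appTop.hom := by
  have e : (h ≫ f).left ≫ repIncl = h.left ≫ f.left ≫ repIncl := by
    rw [Over.comp_left, Category.assoc]
  rw [repPoint, e, repOf, Scheme.Hom.comp_appTop]
  rfl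

theorem iSup_offDiag_repPoint {T : Over baseScheme.{u}} (f : T ⟶ rep Γ) :
    ⨆ γ, offDiag ((repPoint f).rep γ) = ⊤ := by
  have h (γ : Γ) : offDiag ((repPoint f).rep γ) = f.left ⁻¹ᵁ repAt γ := by
    rw [repPoint, ← preimage_repOpensAt]
    rfl
  simp_rw [h, ← Scheme.Hom.preimage_iSup, isOpenCover_repAt Γ |>.iSup_eq_top]
  rfl

/-- The morphism `T ⟶ Rep_2(Γ)_{u/𝔽₂}` given by a representation on `T` whose image generates an
algebra of rank two everywhere. -/
def ofRep {T : Over baseScheme.{u}} (P : TraceZeroRep Γ Γ(T.left, ⊤))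
    (h : ⨆ γ, offDiag (P.rep γ) = ⊤) : T ⟶ rep Γ :=
  Over.homMk (IsOpenImmersion.lift repIncl (toSpec (UnipRing.lift (baseOfOver T) P)) (by
      rw [range_repIncl]
      rintro _ ⟨x, rfl⟩
      have hx : x ∈ ⨆ γ, offDiag (P.rep γ) := by rw [h]; trivial
      rw [SetLike.mem_coe, repOpens_eq]
      rw [TopologicalSpace.Opens.mem_iSup] at hx ⊢
      obtain ⟨γ, hγ⟩ := hx
      refine ⟨γ, ?_⟩
      change x ∈ toSpec (UnipRing.lift (baseOfOver T) P) ⁻¹ᵁ repOpensAt γ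
      rw [preimage_repOpensAt]
      have : repOf (toSpec (UnipRing.lift (baseOfOver T) P)) = P :=
        (congrArg (UnipRing.universal Γ).map (pull_toSpec _)).trans (UnipRing.map_lift _ _)
      rwa [this]))
    (baseScheme_hom_ext _ _)

@[simp] theorem repPoint_ofRep {T : Over baseScheme.{u}} (P : TraceZeroRep Γ Γ(T.left, ⊤))
    (h : ⨆ γ, offDiag (P.rep γ) = ⊤) : repPoint (ofRep P h) = P := by
  have e : (ofRep P h).left ≫ repIncl = toSpec (UnipRing.lift (baseOfOver T) P) :=
    IsOpenImmersion.lift_fac _ _ _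
  rw [repPoint, e]
  exact (congrArg (UnipRing.universal Γ).map (pull_toSpec _)).trans (UnipRing.map_lift _ _)

/-! ### Group actions and quotients -/

section Quotient

variable {S : Scheme.{u}}

/-- A right action of a group scheme `G` on `X` over `S`. -/
structure RightAction (X G : Over S) [GrpObj G] where
  act : X ⊗ G ⟶ X
  act_one : lift (𝟙 X) (toUnit X ≫ MonObj.one) ≫ act = 𝟙 X
  act_mul : act ▷ G ≫ act = (α_ X G G).hom ≫ X ◁ MonObj.mul ≫ act

variable {X Y G : Over S}

/-- The open subscheme of `X ×_S G` on which the functions `σ^* f` and `p₁^* f` are compared. -/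
def commonOpens (σ : X ⊗ G ⟶ X) (π : X ⟶ Y) (U : Y.left.Opens) : (X ⊗ G).left.Opens :=
  σ.left ⁻¹ᵁ (π.left ⁻¹ᵁ U) ⊓ (fst X G).left ⁻¹ᵁ (π.left ⁻¹ᵁ U)

/-- `π : X ⟶ Y` is a geometric quotient of `X` by the action `σ : X ×_S G ⟶ X`. -/
structure IsGeometricQuotient (σ : X ⊗ G ⟶ X) (π : X ⟶ Y) : Prop where
  invariant : σ ≫ π = fst X G ≫ π
  surjective : Function.Surjective π.left
  /-- The image of `(σ, p₁) : X ×_S G ⟶ X ×_S X` is `X ×_Y X`. -/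
  orbits : Set.range (lift σ (fst X G)).left =
    Set.range (lift (pullback.fst π π) (pullback.snd π π)).left
  submersive : ∀ U : Set Y.left, IsOpen U ↔ IsOpen (π.left ⁻¹' U)
  /-- The structure sheaf of `Y` is the sheaf of invariant functions on `X`. -/
  injective_app : ∀ U : Y.left.Opens, Function.Injective (π.left.app U)
  mem_range_app : ∀ (U : Y.left.Opens) (f : Γ(X.left, π.left ⁻¹ᵁ U)),
    f ∈ Set.range (π.left.app U) ↔
      σ.left.appLE (π.left ⁻¹ᵁ U) (commonOpens σ π U) inf_le_left f =
        (fst X G).left.appLE (π.left ⁻¹ᵁ U) (commonOpens σ π U) inf_le_right f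

/-- The action of `G` on `X ×_Y Y'` obtained by base change from an action on `X` for which
`π : X ⟶ Y` is invariant. -/
def baseChangeAct (σ : X ⊗ G ⟶ X) (π : X ⟶ Y) (h : σ ≫ π = fst X G ≫ π)
    {Y' : Over S} (g : Y' ⟶ Y) : pullback π g ⊗ G ⟶ pullback π g :=
  pullback.lift (pullback.fst π g ▷ G ≫ σ) (fst _ _ ≫ pullback.snd π g) (by
    rw [Category.assoc, h, whiskerRight_fst_assoc, pullback.condition, Category.assoc])

/-- `π : X ⟶ Y` is a universal geometric quotient of `X` by the action `σ : X ×_S G ⟶ X`: every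
base change of `π` along a morphism `Y' ⟶ Y` is a geometric quotient. -/
structure IsUniversalGeometricQuotient (σ : X ⊗ G ⟶ X) (π : X ⟶ Y) : Prop where
  invariant : σ ≫ π = fst X G ≫ π
  base_change : ∀ (Y' : Over S) (g : Y' ⟶ Y),
    IsGeometricQuotient (baseChangeAct σ π invariant g) (pullback.snd π g)

end Quotient

variable (Γ) in
/-- The morphism `Rep_2(Γ)_{u/𝔽₂} × PGL₂ ⟶ Rep_2(Γ)_{u/𝔽₂}`, `(ρ, g) ↦ g⁻¹ ∘ ρ`. -/
def repActHom : rep Γ ⊗ pgl.{u} ⟶ rep Γ :=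
  ofRep ((repPoint (fst (rep Γ) pgl)).act (pglPoint (snd (rep Γ) pgl)))
    (top_unique ((iSup_offDiag_repPoint (fst (rep Γ) pgl)).ge.trans
      (iSup_mono fun γ => TraceZeroRep.le_offDiag_act
        (F2.two_eq_zero (baseOfOver (rep Γ ⊗ pgl))) _ _ γ)))

/-- The action on points. -/
theorem repPoint_repActHom {T : Over baseScheme.{u}} (q : T ⟶ rep Γ ⊗ pgl.{u}) :
    repPoint (q ≫ repActHom Γ) =
      (repPoint (q ≫ fst _ _)).act (pglPoint (q ≫ snd _ _)) := by
  rw [repPoint_comp, repActHom, repPoint_ofRep, TraceZeroRep.act_map, ← repPoint_comp,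
    ← pglPoint_comp]

theorem pglPoint_one {T : Over baseScheme.{u}} :
    pglPoint (toUnit T ≫ (MonObj.one : 𝟙_ _ ⟶ pgl.{u})) = 1 := by
  rw [pglPoint_comp]
  have : pglPoint (MonObj.one : 𝟙_ _ ⟶ pgl.{u}) = 1 := pglPoint.apply_symm_apply 1
  rw [this, map_one]

theorem pglPoint_mul {T : Over baseScheme.{u}} (q : T ⟶ pgl.{u} ⊗ pgl.{u}) :
    pglPoint (q ≫ MonObj.mul) = pglPoint (q ≫ fst _ _) * pglPoint (q ≫ snd _ _) := by
  rw [pglPoint_comp]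
  have : pglPoint (MonObj.mul : pgl.{u} ⊗ pgl.{u} ⟶ _) =
    pglPoint (fst _ _) * pglPoint (snd _ _) := pglPoint.apply_symm_apply _
  rw [this, map_mul, ← pglPoint_comp, ← pglPoint_comp]

variable (Γ) in
/-- The right action of `PGL₂ ⊗ 𝔽₂` on `Rep_2(Γ)_{u/𝔽₂}`. -/
def repAction : RightAction (rep Γ) pgl.{u} where
  act := repActHom Γ
  act_one := by
    apply repPoint_injective
    rw [repPoint_repActHom, lift_fst, lift_snd, pglPoint_one, TraceZeroRep.act_one]
  act_mul := by
    apply repPoint_injective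
    rw [repPoint_repActHom, ← Category.assoc (α_ _ _ _).hom, repPoint_repActHom]
    simp only [whiskerRight_fst, whiskerRight_snd, Category.assoc, whiskerLeft_fst,
      whiskerLeft_snd, associator_hom_fst]
    have e := Category.assoc (α_ (rep Γ) pgl.{u} pgl.{u}).hom (snd _ _) MonObj.mul
    rw [repPoint_repActHom, ← e, pglPoint_mul, TraceZeroRep.act_mul]
    simp only [Category.assoc, associator_hom_snd_fst, associator_hom_snd_snd]

end Quotients

end UnipotentMold

end

/-!
The quotient property is deduced from a statement which is visibly stable under base change: `π` has
*local slices* (`HasLocalSlices`). This means that `Y` is covered by open subschemes `V` with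
sections `s : V ⟶ X` of `π`, and that Zariski-locally on `π⁻¹(V)` a point `x` can be moved by the
group to the point `s (π x)`, with a group element depending algebraically on `x`. Together with the
group laws this gives transitivity of the action on the fibres over points with values in a field
(`HasLocalSlices.isTransitiveOnFieldPoints`), hence the condition on `X ×_Y X`. The sections give
surjectivity, submersiveness and injectivity of `𝒪_Y ⟶ π_* 𝒪_X`. An invariant function `f` descends
to `s^* f` on `V`: since `x` and `s (π x)` are locally in one orbit, `f = π^* (s^* f)`, and the local
descents glue (`HasLocalSlices.exists_local`, `HasLocalSlices.mem_range_app`). Local slices and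
transitivity pull back along any `Y' ⟶ Y`.

For `Rep_2(Γ)_{u/𝔽₂} ⟶ Ch_2(Γ)_{u/𝔽₂}` the slice over `Ch_2(Γ)_{u/𝔽₂, α}` is
`γ ↦ a(γ) + b(γ) C`, where `C` is the companion matrix of `t² - d(α)`. If `M = ρ(α)` has an
invertible off-diagonal entry, then one of the standard basis vectors `v` is cyclic for `M`; because
`M² = d(α)` in characteristic two, the matrix `P` with columns `v`, `M v` satisfies `M P = P C`
(`exists_conj_companion`), so that `P⁻¹ ρ P` is the slice
(`TraceZeroRep.exists_act_eq_companionRep`). These `ρ` are all the points over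
`Ch_2(Γ)_{u/𝔽₂, α}`, because the preimage of this open subscheme is `Rep_2(Γ)_{u/𝔽₂, α}`
(`mem_repAt_of_quotientMap`).
-/

noncomputable section

namespace UnipotentMold

section LocalSlices

/-! ### Sections along open immersions -/

theorem section_ext_of_openImmersion {X : Scheme.{u}} {U : X.Opens} {f g : Γ(X, U)}
    (h : ∀ x ∈ U, ∃ (W : Scheme.{u}) (k : W ⟶ X), IsOpenImmersion k ∧ x ∈ Set.range k ∧
      k.app U f = k.app U g) : f = g := by
  apply TopCat.Presheaf.section_ext X.sheaf U
  intro x hx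
  obtain ⟨W, k, hk, ⟨w, rfl⟩, e⟩ := h x hx
  have inj : Function.Injective (k.stalkMap w) :=
    (ConcreteCategory.bijective_of_isIso (k.stalkMap w)).1
  apply inj
  have e1 := k.germ_stalkMap_apply U w hx f
  have e2 := k.germ_stalkMap_apply U w hx g
  exact e1.trans ((congrArg _ e).trans e2.symm)

theorem appLE_appLE_apply {X Y Z : Scheme.{u}} (f : X ⟶ Y) (g : Y ⟶ Z) {k : X ⟶ Z}
    (hk : f ≫ g = k) {U : Z.Opens} {V : Y.Opens} {W : X.Opens} (e₁ : W ≤ f ⁻¹ᵁ V)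
    (e₂ : V ≤ g ⁻¹ᵁ U) (e₃ : W ≤ k ⁻¹ᵁ U) (s : Γ(Z, U)) :
    f.appLE V W e₁ (g.appLE U V e₂ s) = k.appLE U W e₃ s := by
  subst hk
  exact ConcreteCategory.congr_hom (Scheme.Hom.appLE_comp_appLE f g U V W e₂ e₁) s

theorem map_appLE_apply {X Y : Scheme.{u}} (f : X ⟶ Y) {U U' : Y.Opens} {V : X.Opens}
    (e : V ≤ f ⁻¹ᵁ U') (i : U' ≤ U) (s : Γ(Y, U)) :
    f.appLE U' V e (Y.presheaf.map (homOfLE i).op s) =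
      f.appLE U V (e.trans (f.preimage_mono i)) s :=
  ConcreteCategory.congr_hom (f.map_appLE e (homOfLE i).op) s

variable {S : Scheme.{u}} {X Y G : Over S}

/-! ### Local slices and geometric quotients -/

theorem exists_over_lift {T W : Over S} (k : W ⟶ X) [IsOpenImmersion k.left] (x : T ⟶ X)
    (h : Set.range x.left ⊆ Set.range k.left) : ∃ a : T ⟶ W, a ≫ k = x := by
  refine ⟨Over.homMk (IsOpenImmersion.lift k.left x.left h) ?_, ?_⟩
  · rw [← Over.w k, IsOpenImmersion.lift_fac_assoc, Over.w]
  · apply Over.OverMorphism.ext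
    simp [IsOpenImmersion.lift_fac]

theorem mono_of_left {V : Over S} (j : V ⟶ Y) [Mono j.left] : Mono j :=
  ⟨fun a b e => by
    apply Over.OverMorphism.ext
    rw [← cancel_mono j.left, ← Over.comp_left, e, Over.comp_left]⟩

/-- The morphism `π` has local slices for `σ`: `Y` is covered by open subschemes `j : V ⟶ Y` with a
section `s : V ⟶ X` of `π` such that every point of `π⁻¹(V)` has an open neighbourhood
`k : W ⟶ X`, lying over `V` through `w : W ⟶ V`, on which some `h : W ⟶ G` moves the tautological
point `k` to `s ∘ w`. Open subschemes are encoded as arbitrary open immersions. -/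
def HasLocalSlices (σ : X ⊗ G ⟶ X) (π : X ⟶ Y) : Prop :=
  ∀ y : Y.left, ∃ (V : Over S) (j : V ⟶ Y) (s : V ⟶ X), IsOpenImmersion j.left ∧
    y ∈ Set.range j.left ∧ s ≫ π = j ∧
    ∀ x : X.left, π.left x ∈ Set.range j.left →
      ∃ (W : Over S) (k : W ⟶ X) (w : W ⟶ V) (h : W ⟶ G), IsOpenImmersion k.left ∧
        x ∈ Set.range k.left ∧ w ≫ j = k ≫ π ∧ lift k h ≫ σ = w ≫ s

/-- Two points of `X` with values in a field and with the same image under `π` differ by a point of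
`G` with values in the same field. -/
def IsTransitiveOnFieldPoints (σ : X ⊗ G ⟶ X) (π : X ⟶ Y) : Prop :=
  ∀ (K : Type u) [Field K] (p : Spec (CommRingCat.of K) ⟶ S) (x₁ x₂ : Over.mk p ⟶ X),
    x₁ ≫ π = x₂ ≫ π → ∃ g : Over.mk p ⟶ G, lift x₂ g ≫ σ = x₁

/-- `(x · g) · h = x · (g h)` for points with values in `T`. -/
theorem comp_lift_act {T : Over S} [GrpObj G] (A : RightAction X G) (x : T ⟶ X) (g h : T ⟶ G) :
    lift (lift x g ≫ A.act) h ≫ A.act = lift x (lift g h ≫ MonObj.mul) ≫ A.act := by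
  have := congrArg (fun k => lift (lift x g) h ≫ k) A.act_mul
  simpa using this

/-- `x · 1 = x` for points with values in `T`. -/
theorem comp_lift_one {T : Over S} [GrpObj G] (A : RightAction X G) (x : T ⟶ X) :
    lift x (toUnit T ≫ MonObj.one) ≫ A.act = x := by
  have := congrArg (fun k => x ≫ k) A.act_one
  simpa [← Category.assoc, comp_lift] using this

/-- A point of `Spec K` lies in a member of every open cover, so both points can be moved to the
slice through their common image. -/
theorem HasLocalSlices.isTransitiveOnFieldPoints [GrpObj G] {A : RightAction X G} {π : X ⟶ Y}
    (H : HasLocalSlices A.act π) : IsTransitiveOnFieldPoints A.act π := by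
  intro K _ p x₁ x₂ e
  let t : (Over.mk p).left := IsLocalRing.closedPoint K
  have hr {Z : Over S} (z : Over.mk p ⟶ Z) {R : Set Z.left} (h : z.left t ∈ R) :
      Set.range z.left ⊆ R := by
    rintro _ ⟨t', rfl⟩
    obtain rfl : t' = t := Subsingleton.elim (α := PrimeSpectrum K) _ _
    exact h
  obtain ⟨V, j, s, hj, hy, hs, hV⟩ := H ((x₁ ≫ π).left t)
  have hy' : (x₂ ≫ π).left t ∈ Set.range j.left := e ▸ hy
  obtain ⟨W₁, k₁, w₁, h₁, hk₁, hx₁, hw₁, e₁⟩ := hV (x₁.left t) hy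
  obtain ⟨W₂, k₂, w₂, h₂, hk₂, hx₂, hw₂, e₂⟩ := hV (x₂.left t) hy'
  obtain ⟨a₁, rfl⟩ := exists_over_lift k₁ x₁ (hr x₁ hx₁)
  obtain ⟨a₂, rfl⟩ := exists_over_lift k₂ x₂ (hr x₂ hx₂)
  have : Mono j := mono_of_left j
  have ha : a₁ ≫ w₁ = a₂ ≫ w₂ := by
    rw [← cancel_mono j, Category.assoc, Category.assoc, hw₁, hw₂, ← Category.assoc, e,
      Category.assoc]
  have f₁ : lift (a₁ ≫ k₁) (a₁ ≫ h₁) ≫ A.act = a₁ ≫ w₁ ≫ s := by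
    rw [← comp_lift, Category.assoc, e₁]
  have f₂ : lift (a₂ ≫ k₂) (a₂ ≫ h₂) ≫ A.act = a₁ ≫ w₁ ≫ s := by
    rw [← comp_lift, Category.assoc, e₂, ← Category.assoc, ← ha, Category.assoc]
  -- Both points are moved to the slice, by `h₁` and `h₂`, so that `x₁ = x₂ · (h₂ h₁⁻¹)`.
  refine ⟨lift (a₂ ≫ h₂) ((a₁ ≫ h₁) ≫ GrpObj.inv) ≫ MonObj.mul, ?_⟩
  rw [← comp_lift_act, f₂, ← f₁, comp_lift_act, GrpObj.lift_comp_inv_right, comp_lift_one]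

theorem HasLocalSlices.surjective {σ : X ⊗ G ⟶ X} {π : X ⟶ Y} (H : HasLocalSlices σ π) :
    Function.Surjective π.left := by
  intro y
  obtain ⟨V, j, s, -, ⟨v, rfl⟩, rfl, -⟩ := H y
  exact ⟨s.left v, rfl⟩

theorem HasLocalSlices.isOpen_iff {σ : X ⊗ G ⟶ X} {π : X ⟶ Y} (H : HasLocalSlices σ π)
    (U : Set Y.left) : IsOpen U ↔ IsOpen (π.left ⁻¹' U) := by
  refine ⟨fun h => h.preimage π.left.continuous, fun h => isOpen_iff_forall_mem_open.2 ?_⟩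
  intro y hy
  obtain ⟨V, j, s, hj, ⟨v, rfl⟩, rfl, -⟩ := H y
  refine ⟨(s ≫ π).left '' ((s ≫ π).left ⁻¹' U), Set.image_preimage_subset _ _,
    (s ≫ π).left.isOpenEmbedding.isOpenMap _ ?_, ⟨v, hy, rfl⟩⟩
  exact h.preimage s.left.continuous

theorem HasLocalSlices.injective_app {σ : X ⊗ G ⟶ X} {π : X ⟶ Y} (H : HasLocalSlices σ π)
    (U : Y.left.Opens) : Function.Injective (π.left.app U) := by
  intro f g e
  refine section_ext_of_openImmersion fun y hy => ?_
  obtain ⟨V, j, s, hj, hv, rfl, -⟩ := H y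
  refine ⟨_, _, hj, hv, ?_⟩
  have h (a : Γ(Y.left, U)) : (s ≫ π).left.app U a = s.left.app _ (π.left.app U a) :=
    ConcreteCategory.congr_hom (Scheme.Hom.comp_app s.left π.left U) a
  exact (h f).trans ((congrArg _ e).trans (h g).symm)

/-- Invariant functions descend locally: on `O = U ∩ j(V)` the descent of `f` is the function that
corresponds to `s^* f` on `V`. -/
theorem HasLocalSlices.exists_local {σ : X ⊗ G ⟶ X} {π : X ⟶ Y} (H : HasLocalSlices σ π)
    {U : Y.left.Opens} {f : Γ(X.left, π.left ⁻¹ᵁ U)}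
    (hf : σ.left.appLE (π.left ⁻¹ᵁ U) (commonOpens σ π U) inf_le_left f =
        (fst X G).left.appLE (π.left ⁻¹ᵁ U) (commonOpens σ π U) inf_le_right f)
    {y : Y.left} (hy : y ∈ U) :
    ∃ (O : Y.left.Opens) (hO : O ≤ U), y ∈ O ∧ ∃ g : Γ(Y.left, O),
      π.left.app O g = X.left.presheaf.map (homOfLE (π.left.preimage_mono hO)).op f := by
  obtain ⟨V, j, s, hj, hv, e, hV⟩ := H y
  let O : Y.left.Opens := U ⊓ j.left.opensRange
  have hs : j.left ⁻¹ᵁ O ≤ s.left ⁻¹ᵁ π.left ⁻¹ᵁ U := by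
    subst e
    exact (s ≫ π).left.preimage_mono (inf_le_left : O ≤ U)
  have hiso : IsIso (j.left.app O) := j.left.isIso_app O inf_le_right
  obtain ⟨g, hg⟩ := (ConcreteCategory.bijective_of_isIso (j.left.app O)).2
    (s.left.appLE (π.left ⁻¹ᵁ U) (j.left ⁻¹ᵁ O) hs f)
  refine ⟨O, inf_le_left, ⟨hy, hv⟩, g, section_ext_of_openImmersion fun x hx => ?_⟩
  obtain ⟨W, k, w, h, hk, hxk, hw, hσ⟩ := hV x hx.2
  refine ⟨_, k.left, hk, hxk, ?_⟩
  let Q : W.left.Opens := k.left ⁻¹ᵁ π.left ⁻¹ᵁ O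
  have hkQ : Q ≤ k.left ⁻¹ᵁ π.left ⁻¹ᵁ U :=
    k.left.preimage_mono (π.left.preimage_mono (inf_le_left : O ≤ U))
  have hwQ : Q ≤ w.left ⁻¹ᵁ j.left ⁻¹ᵁ O := by
    have : w.left ≫ j.left = k.left ≫ π.left := congrArg (fun k => k.left) hw
    change (k.left ≫ π.left) ⁻¹ᵁ O ≤ (w.left ≫ j.left) ⁻¹ᵁ O
    rw [this]
  have h₁ : (lift k h).left ≫ σ.left = w.left ≫ s.left := congrArg (fun k => k.left) hσ
  have h₂ : (lift k h).left ≫ (fst X G).left = k.left :=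
    congrArg (fun k => k.left) (lift_fst k h)
  have hc₁ : Q ≤ ((lift k h).left ≫ σ.left) ⁻¹ᵁ π.left ⁻¹ᵁ U := by
    rw [h₁]
    exact hwQ.trans (w.left.preimage_mono hs)
  have hc₂ : Q ≤ ((lift k h).left ≫ (fst X G).left) ⁻¹ᵁ π.left ⁻¹ᵁ U := by rwa [h₂]
  have hc : Q ≤ (lift k h).left ⁻¹ᵁ commonOpens σ π U := fun x hx => ⟨hc₁ hx, hc₂ hx⟩
  have hwj : w.left ≫ j.left = k.left ≫ π.left := congrArg (fun k => k.left) hw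
  -- On `W` the function `f` is `(k, h)^* p₁^* f = (k, h)^* σ^* f = w^* s^* f`, and `s^* f = j^* g`,
  -- so `f` agrees with `w^* j^* g = k^* π^* g`.
  rw [Scheme.Hom.app_eq_appLE] at hg
  rw [Scheme.Hom.app_eq_appLE, Scheme.Hom.app_eq_appLE, map_appLE_apply,
    appLE_appLE_apply k.left π.left hwj.symm le_rfl le_rfl (hwQ.trans le_rfl),
    ← appLE_appLE_apply w.left j.left rfl hwQ le_rfl, hg,
    appLE_appLE_apply w.left s.left h₁.symm hwQ hs hc₁,
    ← appLE_appLE_apply (lift k h).left σ.left rfl hc inf_le_left, hf,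
    appLE_appLE_apply (lift k h).left (fst X G).left h₂ hc inf_le_right hkQ]

theorem HasLocalSlices.mem_range_app {σ : X ⊗ G ⟶ X} {π : X ⟶ Y} (H : HasLocalSlices σ π)
    (inv : σ ≫ π = fst X G ≫ π) (U : Y.left.Opens) (f : Γ(X.left, π.left ⁻¹ᵁ U)) :
    f ∈ Set.range (π.left.app U) ↔
      σ.left.appLE (π.left ⁻¹ᵁ U) (commonOpens σ π U) inf_le_left f =
        (fst X G).left.appLE (π.left ⁻¹ᵁ U) (commonOpens σ π U) inf_le_right f := by
  constructor
  · rintro ⟨g, rfl⟩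
    have e : σ.left ≫ π.left = (fst X G).left ≫ π.left := congrArg (fun k => k.left) inv
    have h₁ := Scheme.Hom.comp_appLE σ.left π.left U (commonOpens σ π U) inf_le_left
    have h₂ := Scheme.Hom.comp_appLE (fst X G).left π.left U (commonOpens σ π U) inf_le_right
    rw [← CommRingCat.comp_apply, ← CommRingCat.comp_apply, ← h₁, ← h₂]
    simp only [e]
  · intro hf
    choose O hO hyO g hg using fun y : U => H.exists_local hf y.2
    obtain ⟨(b : Γ(Y.left, U)), hb, -⟩ := Y.left.sheaf.existsUnique_gluing' O U
      (fun y => homOfLE (hO y))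
      (fun y hy => TopologicalSpace.Opens.mem_iSup.2 ⟨⟨y, hy⟩, hyO ⟨y, hy⟩⟩) g (by
        intro y z
        apply H.injective_app
        have e (t : U) (h : O y ⊓ O z ≤ O t) :
            π.left.app (O y ⊓ O z) (Y.left.presheaf.map (homOfLE h).op (g t)) =
              X.left.presheaf.map (homOfLE (π.left.preimage_mono (h.trans (hO t)))).op f := by
          rw [← CommRingCat.comp_apply, π.left.naturality, CommRingCat.comp_apply, hg]
          exact (ConcreteCategory.congr_hom (X.left.presheaf.map_comp _ _) f).symm
        exact (e y inf_le_left).trans (e z inf_le_right).symm)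
    refine ⟨b, ?_⟩
    apply X.left.sheaf.eq_of_locally_eq' (fun y => π.left ⁻¹ᵁ O y) _
      (fun y => homOfLE (π.left.preimage_mono (hO y)))
      (fun x hx => TopologicalSpace.Opens.mem_iSup.2 ⟨⟨π.left x, hx⟩, hyO ⟨π.left x, hx⟩⟩)
    intro y
    refine Eq.trans ?_ (hg y)
    have : Y.left.presheaf.map (homOfLE (hO y)).op b = g y := hb y
    rw [← this]
    exact (ConcreteCategory.congr_hom (π.left.naturality (homOfLE (hO y)).op) b).symm

/-- The points of `X ×_Y X` are tested on their residue fields. -/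
theorem IsTransitiveOnFieldPoints.range_eq {σ : X ⊗ G ⟶ X} {π : X ⟶ Y}
    (H : IsTransitiveOnFieldPoints σ π) (inv : σ ≫ π = fst X G ≫ π) :
    Set.range (lift σ (fst X G)).left =
      Set.range (lift (pullback.fst π π) (pullback.snd π π)).left := by
  apply Set.Subset.antisymm
  · have : lift σ (fst X G) =
        pullback.lift σ (fst X G) inv ≫ lift (pullback.fst π π) (pullback.snd π π) := by
      rw [comp_lift, pullback.lift_fst, pullback.lift_snd]
    rw [this]
    rintro _ ⟨z, rfl⟩
    exact ⟨(pullback.lift σ (fst X G) inv).left z, rfl⟩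
  · rintro _ ⟨z, rfl⟩
    let Z := pullback π π
    let p := Z.left.fromSpecResidueField z
    let q : Over.mk (p ≫ Z.hom) ⟶ Z := Over.homMk p
    obtain ⟨g, hg⟩ := H (Z.left.residueField z) (p ≫ Z.hom) (q ≫ pullback.fst π π)
      (q ≫ pullback.snd π π) (by rw [Category.assoc, Category.assoc, pullback.condition])
    have e : q ≫ lift (pullback.fst π π) (pullback.snd π π) =
        lift (q ≫ pullback.snd π π) g ≫ lift σ (fst X G) := by
      rw [comp_lift, comp_lift, hg, lift_fst]
    let t : (Over.mk (p ≫ Z.hom)).left := IsLocalRing.closedPoint (Z.left.residueField z)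
    have hz : q.left t = z := Z.left.fromSpecResidueField_apply z _
    refine ⟨(lift (q ≫ pullback.snd π π) g).left t, ?_⟩
    exact (congrArg (fun k => k.left t) e).symm.trans
      (congrArg (lift (pullback.fst π π) (pullback.snd π π)).left hz)

theorem HasLocalSlices.isGeometricQuotient {σ : X ⊗ G ⟶ X} {π : X ⟶ Y}
    (H : HasLocalSlices σ π) (H' : IsTransitiveOnFieldPoints σ π)
    (inv : σ ≫ π = fst X G ≫ π) : IsGeometricQuotient σ π where
  invariant := inv
  surjective := H.surjective
  orbits := H'.range_eq inv
  submersive := H.isOpen_iff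
  injective_app := H.injective_app
  mem_range_app := H.mem_range_app inv

/-! ### Base change of local slices -/

theorem over_isPullback_left {P X Y Z : Over S} {a : P ⟶ X} {b : P ⟶ Y} {f : X ⟶ Z} {g : Y ⟶ Z}
    (h : IsPullback a b f g) : IsPullback a.left b.left f.left g.left :=
  h.map (Over.forget S)

theorem isOpenImmersion_fst_left {X Y Z : Over S} (f : X ⟶ Z) (g : Y ⟶ Z)
    [IsOpenImmersion g.left] : IsOpenImmersion (pullback.fst f g).left :=
  MorphismProperty.of_isPullback (P := @IsOpenImmersion)
    (over_isPullback_left (IsPullback.of_hasPullback f g)).flip inferInstance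

theorem range_fst_left {X Y Z : Over S} (f : X ⟶ Z) (g : Y ⟶ Z) :
    Set.range (pullback.fst f g).left = f.left ⁻¹' Set.range g.left := by
  have h := over_isPullback_left (IsPullback.of_hasPullback f g)
  rw [← Scheme.Pullback.range_fst, ← h.isoPullback_hom_fst]
  apply Set.Subset.antisymm
  · rintro _ ⟨z, rfl⟩
    exact ⟨h.isoPullback.hom z, rfl⟩
  · rintro _ ⟨z, rfl⟩
    refine ⟨h.isoPullback.inv z, ?_⟩
    rw [h.isoPullback_hom_fst, ← h.isoPullback_inv_fst]
    rfl

theorem baseChangeAct_invariant (σ : X ⊗ G ⟶ X) (π : X ⟶ Y) (h : σ ≫ π = fst X G ≫ π)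
    {Y' : Over S} (g : Y' ⟶ Y) :
    baseChangeAct σ π h g ≫ pullback.snd π g = fst _ _ ≫ pullback.snd π g :=
  pullback.lift_snd _ _ _

theorem lift_baseChangeAct {T : Over S} (σ : X ⊗ G ⟶ X) (π : X ⟶ Y) (h : σ ≫ π = fst X G ≫ π)
    {Y' : Over S} (g : Y' ⟶ Y) (x : T ⟶ pullback π g) (c : T ⟶ G) :
    (lift x c ≫ baseChangeAct σ π h g) ≫ pullback.fst π g =
      lift (x ≫ pullback.fst π g) c ≫ σ := by
  rw [Category.assoc, baseChangeAct, pullback.lift_fst, lift_whiskerRight_assoc]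

theorem IsTransitiveOnFieldPoints.baseChange {σ : X ⊗ G ⟶ X} {π : X ⟶ Y}
    (H : IsTransitiveOnFieldPoints σ π) (inv : σ ≫ π = fst X G ≫ π) {Y' : Over S} (g : Y' ⟶ Y) :
    IsTransitiveOnFieldPoints (baseChangeAct σ π inv g) (pullback.snd π g) := by
  intro K _ p x₁ x₂ e
  obtain ⟨c, hc⟩ := H K p (x₁ ≫ pullback.fst π g) (x₂ ≫ pullback.fst π g) (by
    rw [Category.assoc, Category.assoc, pullback.condition, ← Category.assoc, e, Category.assoc])
  refine ⟨c, pullback.hom_ext ?_ ?_⟩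
  · rw [lift_baseChangeAct, hc]
  · rw [Category.assoc, baseChangeAct_invariant, lift_fst_assoc, e]

theorem HasLocalSlices.baseChange {σ : X ⊗ G ⟶ X} {π : X ⟶ Y}
    (H : HasLocalSlices σ π) (inv : σ ≫ π = fst X G ≫ π) {Y' : Over S} (g : Y' ⟶ Y) :
    HasLocalSlices (baseChangeAct σ π inv g) (pullback.snd π g) := by
  intro y'
  obtain ⟨V, j, s, hj, hv, rfl, hV⟩ := H (g.left y')
  have hj' := isOpenImmersion_fst_left g (s ≫ π)
  refine ⟨pullback g (s ≫ π), pullback.fst _ _,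
    pullback.lift (pullback.snd _ _ ≫ s) (pullback.fst _ _) (by
      rw [Category.assoc, pullback.condition]), hj', ?_, pullback.lift_snd _ _ _, ?_⟩
  · rw [range_fst_left]
    exact hv
  · intro x' hx'
    rw [range_fst_left] at hx'
    have hx : π.left ((pullback.fst π g).left x') ∈ Set.range (s ≫ π).left := by
      have := congrArg (fun k => k.left x') (pullback.condition (f := π) (g := g))
      exact (show π.left ((pullback.fst π g).left x') = g.left ((pullback.snd π g).left x') from
        this) ▸ hx'
    obtain ⟨W, k, w, h, hk, hxk, hw, e⟩ := hV _ hx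
    refine ⟨pullback (pullback.fst π g) k, pullback.fst _ _,
      pullback.lift (pullback.fst _ _ ≫ pullback.snd _ _) (pullback.snd _ _ ≫ w) (by
        rw [Category.assoc, Category.assoc, hw, ← pullback.condition, ← Category.assoc,
          pullback.condition, Category.assoc]), pullback.snd _ _ ≫ h,
      isOpenImmersion_fst_left _ _, ?_, pullback.lift_fst _ _ _, ?_⟩
    · rw [range_fst_left]
      exact hxk
    · apply pullback.hom_ext
      · rw [lift_baseChangeAct, Category.assoc, pullback.lift_fst, pullback.lift_snd_assoc,
          Category.assoc, ← e, ← Category.assoc, comp_lift]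
        simp only [pullback.condition]
      · rw [Category.assoc, baseChangeAct_invariant, lift_fst_assoc, Category.assoc,
          pullback.lift_snd, pullback.lift_fst]

theorem HasLocalSlices.isUniversalGeometricQuotient [GrpObj G] {A : RightAction X G} {π : X ⟶ Y}
    (H : HasLocalSlices A.act π) (inv : A.act ≫ π = fst X G ≫ π) :
    IsUniversalGeometricQuotient A.act π where
  invariant := inv
  base_change _ g := (H.baseChange inv g).isGeometricQuotient
    (H.isTransitiveOnFieldPoints.baseChange inv g) (baseChangeAct_invariant _ _ _ _)

end LocalSlices

section Companion

/-! ### Conjugation to companion matrices -/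

variable {Γ : Type u} [Monoid Γ]

/-- The companion matrix of the polynomial `t² - d`. -/
def companion {R : Type v} [CommRing R] (d : R) : Matrix (Fin 2) (Fin 2) R := !![0, d; 1, 0]

theorem companion_mul_self {R : Type v} [CommRing R] (d : R) :
    companion d * companion d = d • 1 := by
  ext i j
  fin_cases i <;> fin_cases j <;> simp [companion]

/-- The representation `γ ↦ a(γ) + b(γ) C` attached to `(a, b)`-coefficients with respect to
`(d, α)`, where `C` is the companion matrix of `t² - d(α)`. -/
def ABCoeff.companionRep {R : Type v} [CommRing R] {α : Γ} (h2 : (2 : R) = 0)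
    (Q : ABCoeff Γ R α) : TraceZeroRep Γ R where
  rep :=
    { toFun γ := Q.a γ • 1 + Q.b γ • companion (Q.d α)
      map_one' := by simp [Q.a_one, Q.b_one]
      map_mul' γ δ := by
        simp only [mul_add, add_mul, smul_mul_smul_comm, one_mul, mul_one, companion_mul_self,
          Q.a_mul, Q.b_mul, add_smul, smul_smul]
        abel }
  trace_eq_zero γ := by
    simp [Matrix.trace_fin_two, companion, ← two_mul, h2]
  minor_eq_zero g r := by
    simp [Matrix.det_fin_three]
    ring

theorem ABCoeff.companionRep_apply {R : Type v} [CommRing R] {α : Γ} (h2 : (2 : R) = 0)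
    (Q : ABCoeff Γ R α) (γ : Γ) :
    (Q.companionRep h2).rep γ = Q.a γ • 1 + Q.b γ • companion (Q.d α) := rfl

theorem ABCoeff.companionRep_self {R : Type v} [CommRing R] {α : Γ} (h2 : (2 : R) = 0)
    (Q : ABCoeff Γ R α) : (Q.companionRep h2).rep α = companion (Q.d α) := by
  simp [companionRep_apply, Q.a_self, Q.b_self]

theorem map_smul_one_add_smul {R : Type v} [CommRing R] {R' : Type w} [CommRing R'] (f : R →+* R')
    (a b : R) (M : Matrix (Fin 2) (Fin 2) R) :
    (a • 1 + b • M).map f = f a • 1 + f b • M.map f := by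
  ext i j
  simp [Matrix.one_apply, apply_ite f]

theorem ABCoeff.companionRep_map {R : Type v} [CommRing R] {R' : Type w} [CommRing R'] {α : Γ}
    (h2 : (2 : R) = 0) (h2' : (2 : R') = 0) (Q : ABCoeff Γ R α) (f : R →+* R') :
    (Q.companionRep h2).map f = (Q.map f).companionRep h2' :=
  TraceZeroRep.ext' fun γ => by
    rw [TraceZeroRep.map_rep, companionRep_apply, companionRep_apply, map_smul_one_add_smul]
    congr 2
    ext i j
    fin_cases i <;> fin_cases j <;> simp [companion, ABCoeff.map]

/-- If `a`, `b` are the coefficients of `ρ`, then `ρ(α)² = d(α)`. This identifies `d(α)` without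
reference to determinants. -/
theorem mul_self_of_coeff {R : Type v} [CommRing R] {α : Γ} {P : TraceZeroRep Γ R}
    {Q : ABCoeff Γ R α} (h : ∀ γ, P.rep γ = Q.a γ • 1 + Q.b γ • P.rep α) :
    P.rep α * P.rep α = Q.d α • 1 := by
  rw [← map_mul, h (α * α), Q.a_mul, Q.b_mul, Q.a_self, Q.b_self]
  simp

/-- In characteristic two, a trace zero matrix with square `d` and with an invertible off-diagonal
entry is conjugate to the companion matrix of `t² - d`. -/
theorem exists_conj_companion {R : Type v} [CommRing R] (h2 : (2 : R) = 0)
    {M : Matrix (Fin 2) (Fin 2) R} (ht : M.trace = 0) {d : R} (hd : M * M = d • 1)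
    (h : IsUnit (M 0 1) ∨ IsUnit (M 1 0)) :
    ∃ P : GL (Fin 2) R, M * P.val = P.val * companion d := by
  have h11 := apply_eq_of_trace h2 ht
  have h00 : M 0 0 * M 0 0 + M 0 1 * M 1 0 = d := by
    simpa [Matrix.mul_apply] using congrFun (congrFun hd 0) 0
  -- The columns of `P` are `v` and `M v`, for `v` the second or the first standard basis vector.
  rcases h with h | h
  · have hP : IsUnit (!![0, M 0 1; 1, M 0 0] : Matrix (Fin 2) (Fin 2) R).det := by
      simpa [Matrix.det_fin_two] using h
    refine ⟨Matrix.nonsingInvUnit _ hP, ?_⟩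
    change M * !![0, M 0 1; 1, M 0 0] = !![0, M 0 1; 1, M 0 0] * companion d
    ext i j
    fin_cases i <;> fin_cases j <;> simp [Matrix.mul_apply, companion, h11]
    · linear_combination (M 0 0 * M 0 1) * h2
    · linear_combination h00
  · have hP : IsUnit (!![1, M 0 0; 0, M 1 0] : Matrix (Fin 2) (Fin 2) R).det := by
      simpa [Matrix.det_fin_two] using h
    refine ⟨Matrix.nonsingInvUnit _ hP, ?_⟩
    change M * !![1, M 0 0; 0, M 1 0] = !![1, M 0 0; 0, M 1 0] * companion d
    ext i j
    fin_cases i <;> fin_cases j <;> simp [Matrix.mul_apply, companion, h11]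
    · linear_combination h00
    · linear_combination (M 0 0 * M 1 0) * h2

/-- Conjugation by an invertible matrix, as an element of `AutM2 R`. -/
theorem AutM2.exists_conj {R : Type v} [CommRing R] (P : GL (Fin 2) R) :
    ∃ g : AutM2 R, ∀ x, AutM2.toAlgEquiv g⁻¹ x = P⁻¹.val * x * P.val := by
  let φ : Matrix (Fin 2) (Fin 2) R ≃ₐ[R] Matrix (Fin 2) (Fin 2) R :=
    AlgEquiv.ofAlgHom
      (AlgHom.ofLinearMap
        ((LinearMap.mulRight R P.val).comp (LinearMap.mulLeft R P⁻¹.val)) (by simp)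
        (fun x y => by simp [mul_assoc]))
      (AlgHom.ofLinearMap
        ((LinearMap.mulRight R P⁻¹.val).comp (LinearMap.mulLeft R P.val)) (by simp)
        (fun x y => by simp [mul_assoc]))
      (AlgHom.ext fun x => by simp [mul_assoc]) (AlgHom.ext fun x => by simp [mul_assoc])
  obtain ⟨g, hg⟩ := AutM2.toAlgEquiv_bijective.2 φ
  exact ⟨g⁻¹, fun x => by rw [inv_inv, hg]; rfl⟩

/-- The coefficients of a representation are invariant under the action. -/
theorem TraceZeroRep.act_coeff {R : Type v} [CommRing R] {α : Γ} {P : TraceZeroRep Γ R}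
    {Q : ABCoeff Γ R α} (h : ∀ γ, P.rep γ = Q.a γ • 1 + Q.b γ • P.rep α) (g : AutM2 R) (γ : Γ) :
    (P.act g).rep γ = Q.a γ • 1 + Q.b γ • (P.act g).rep α := by
  rw [act_rep, h γ, map_add, map_smul, map_smul, map_one, act_rep]

theorem TraceZeroRep.exists_act_eq_companionRep {R : Type v} [CommRing R] {α : Γ} (h2 : (2 : R) = 0)
    {P : TraceZeroRep Γ R} {Q : ABCoeff Γ R α}
    (h : ∀ γ, P.rep γ = Q.a γ • 1 + Q.b γ • P.rep α)
    (hu : IsUnit (P.rep α 0 1) ∨ IsUnit (P.rep α 1 0)) :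
    ∃ g : AutM2 R, P.act g = Q.companionRep h2 := by
  obtain ⟨p, hp⟩ := exists_conj_companion h2 (P.trace_eq_zero α) (mul_self_of_coeff h) hu
  obtain ⟨g, hg⟩ := AutM2.exists_conj p
  refine ⟨g, TraceZeroRep.ext' fun γ => ?_⟩
  rw [TraceZeroRep.act_coeff h, TraceZeroRep.act_rep, hg, mul_assoc, hp, ← mul_assoc,
    Units.inv_mul, one_mul, ABCoeff.companionRep_apply]

end Companion

section Slices

/-! ### Slices for the morphism from representations to coefficients -/

variable {Γ : Type u} [Monoid Γ]

theorem offDiag_repPoint {T : Over baseScheme.{u}} (f : T ⟶ rep Γ) (α : Γ) :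
    offDiag ((repPoint f).rep α) = f.left ⁻¹ᵁ repAt α := by
  rw [repPoint, ← preimage_repOpensAt]
  rfl

/-- The composite of a morphism to `Rep_2(Γ)_{u/𝔽₂, α}` with `π` is given by any
`(a, b)`-coefficients of the representation. -/
theorem quotientMap_eq_of_coeff {T : Over baseScheme.{u}} (f : T ⟶ rep Γ) {α : Γ}
    (hα : offDiag ((repPoint f).rep α) = ⊤) (g : T.left ⟶ chAffine α)
    (hg : ∀ γ, (repPoint f).rep γ =
      (coeffOf g).a γ • 1 + (coeffOf g).b γ • (repPoint f).rep α) :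
    f.left ≫ quotientMapLeft Γ = g ≫ chι α := by
  have hr : Set.range f.left ⊆ Set.range (repAt α).ι := by
    rw [Scheme.Opens.range_ι]
    rintro _ ⟨x, rfl⟩
    have : x ∈ f.left ⁻¹ᵁ repAt α := by
      rw [← offDiag_repPoint, hα]
      trivial
    exact this
  let p := IsOpenImmersion.lift (repAt α).ι f.left hr
  have hp : p ≫ (repAt α).ι = f.left := IsOpenImmersion.lift_fac _ _ _
  have e : (repOf ((repAt α).ι ≫ repIncl)).map p.appTop.hom = repPoint f := by
    rw [repPoint, ← hp, Category.assoc]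
    rw [repOf, repOf, Scheme.Hom.comp_appTop p]
    rfl
  have hgp : p ≫ quotientMapAt α = g := by
    apply coeffOf_injective
    have h2 : (2 : Γ(T.left, ⊤)) = 0 := F2.two_eq_zero (baseOfOver T)
    rw [coeffOf_comp, quotientMapAt, coeffOf_ofCoeff, TraceZeroRep.coeff_map p _ h2 _ _ _
      (by rw [e]; exact hα)]
    apply TraceZeroRep.coeff_unique
    intro γ
    rw [e]
    exact hg γ
  rw [← hgp, ← hp, Category.assoc, Category.assoc]
  congr 1
  exact repAt_quotientMap α

theorem exists_coeffHom {T : Over baseScheme.{u}} (f : T ⟶ rep Γ) {α : Γ}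
    (hα : offDiag ((repPoint f).rep α) = ⊤) : ∃ g : T.left ⟶ chAffine α,
    ∀ γ, (repPoint f).rep γ =
      (coeffOf g).a γ • 1 + (coeffOf g).b γ • (repPoint f).rep α := by
  have h2 : (2 : Γ(T.left, ⊤)) = 0 := F2.two_eq_zero (baseOfOver T)
  refine ⟨ofCoeff (baseOfOver T) ((repPoint f).coeff h2 α hα), fun γ => ?_⟩
  rw [coeffOf_ofCoeff]
  exact TraceZeroRep.coeff_spec h2 _ α hα γ

/-- An open subscheme of a scheme over `𝔽₂`, as a scheme over `𝔽₂`. -/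
abbrev overOpen (T : Over baseScheme.{u}) (U : T.left.Opens) : Over baseScheme.{u} :=
  Over.mk (U.ι ≫ T.hom)

/-- The inclusion of an open subscheme. -/
abbrev overOpenι (T : Over baseScheme.{u}) (U : T.left.Opens) : overOpen T U ⟶ T :=
  Over.homMk U.ι

variable (Γ) in
/-- On the open subscheme where `ρ(α)` generates an algebra of rank two, both composites are given by
the coefficients with respect to `α`, which are the same for `ρ` and for `g⁻¹ ∘ ρ`. -/
theorem quotientMap_invariant :
    repActHom Γ ≫ quotientMap Γ = fst (rep Γ) pgl ≫ quotientMap Γ := by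
  apply Over.OverMorphism.ext
  apply Scheme.hom_ext_of_forall
  intro x
  have hx : (fst (rep Γ) pgl).left x ∈ ⨆ α, repAt (Γ := Γ) α := by
    rw [(isOpenCover_repAt Γ).iSup_eq_top]
    trivial
  obtain ⟨α, hα⟩ := TopologicalSpace.Opens.mem_iSup.1 hx
  let U := (fst (rep Γ) pgl).left ⁻¹ᵁ repAt α
  let k := overOpenι (rep Γ ⊗ pgl) U
  have h₁ : offDiag ((repPoint (k ≫ fst (rep Γ) pgl)).rep α) = ⊤ := by
    rw [offDiag_repPoint]
    exact U.ι_preimage_self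
  have e := repPoint_repActHom k
  have h₂ : offDiag ((repPoint (k ≫ repActHom Γ)).rep α) = ⊤ := by
    rw [e]
    exact top_unique (h₁.ge.trans (TraceZeroRep.le_offDiag_act
      (F2.two_eq_zero (baseOfOver (overOpen (rep Γ ⊗ pgl) U))) _ _ α))
  obtain ⟨g, hg⟩ := exists_coeffHom _ h₁
  refine ⟨U, hα, ?_⟩
  have e₁ := quotientMap_eq_of_coeff _ h₁ g hg
  have e₂ := quotientMap_eq_of_coeff _ h₂ g (by
    rw [e]
    exact TraceZeroRep.act_coeff hg _)
  exact (Category.assoc _ _ _).symm.trans (e₂.trans (e₁.symm.trans (Category.assoc _ _ _)))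

instance (α : Γ) : IsOpenImmersion (chι α) :=
  (chGlue Γ).ι_isOpenImmersion α

theorem isUnit_of_basicOpen_eq_top {X : Scheme.{u}} {f : Γ(X, ⊤)} (h : X.basicOpen f = ⊤) :
    IsUnit f :=
  X.toLocallyRingedSpace.toRingedSpace.isUnit_of_isUnit_germ ⊤ f fun x hx =>
    (X.mem_basicOpen f x hx).1 (h.ge hx)

theorem offDiag_smul_one_add_smul {X : Scheme.{u}} (a : Γ(X, ⊤)) {b : Γ(X, ⊤)} (hb : IsUnit b)
    (M : Matrix (Fin 2) (Fin 2) Γ(X, ⊤)) : offDiag (a • 1 + b • M) = offDiag M := by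
  simp [offDiag, Scheme.basicOpen_mul, Scheme.basicOpen_of_isUnit _ hb]

/-- The preimage of `Ch_2(Γ)_{u/𝔽₂, α}` is contained in `Rep_2(Γ)_{u/𝔽₂, α}`: on
`Rep_2(Γ)_{u/𝔽₂, β}` the points over `Ch_2(Γ)_{u/𝔽₂, α}` are those where `b_β(α)` is invertible, by
the gluing of the charts, and there `ρ(α) = a_β(α) + b_β(α) ρ(β)` is not scalar. -/
theorem mem_repAt_of_quotientMap {α : Γ} {x : (rep Γ).left}
    (hx : quotientMapLeft Γ x ∈ Set.range (chι α)) : x ∈ repAt α := by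
  have hc : x ∈ ⨆ α, repAt (Γ := Γ) α := by
    rw [(isOpenCover_repAt Γ).iSup_eq_top]
    trivial
  obtain ⟨β, hβ⟩ := TopologicalSpace.Opens.mem_iSup.1 hc
  let x' : (repAt β).toScheme := ⟨x, hβ⟩
  obtain ⟨y, hy⟩ := hx
  have e : chι β (quotientMapAt β x') = chι α y := by
    rw [hy]
    exact (congrArg (fun k => k x') (repAt_quotientMap β)).symm
  obtain ⟨z, hz, -⟩ := ((chGlue Γ).ι_eq_iff β α _ _).1 e
  let W : (repAt β).toScheme.Opens := quotientMapAt β ⁻¹ᵁ (chIncl β α).opensRange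
  have hW : Set.range (W.ι ≫ quotientMapAt β) ⊆ Set.range (chIncl β α) := by
    rintro _ ⟨w, rfl⟩
    exact w.2
  have hb : IsUnit ((coeffOf (W.ι ≫ quotientMapAt β)).b α) := by
    rw [← IsOpenImmersion.lift_fac (chIncl β α) _ hW]
    exact isUnit_coeffOf_comp _ _ (isUnit_chIncl β α)
  let f : Over.mk ((W.ι ≫ (repAt β).ι) ≫ (rep Γ).hom) ⟶ rep Γ := Over.homMk (W.ι ≫ (repAt β).ι)
  have hβ : offDiag ((repPoint f).rep β) = ⊤ := by
    rw [offDiag_repPoint]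
    change W.ι ⁻¹ᵁ ((repAt β).ι ⁻¹ᵁ repAt β) = ⊤
    rw [Scheme.Opens.ι_preimage_self]
    rfl
  obtain ⟨g, hg⟩ := exists_coeffHom f hβ
  have hgW : g = W.ι ≫ quotientMapAt β := by
    rw [← cancel_mono (chι β), ← quotientMap_eq_of_coeff f hβ g hg]
    exact (Category.assoc _ _ _).trans ((congrArg (fun k => W.ι ≫ k)
      (repAt_quotientMap β)).trans (Category.assoc _ _ _).symm)
  have hα : offDiag ((repPoint f).rep α) = ⊤ := by
    rw [hg α, offDiag_smul_one_add_smul _ (by rw [hgW]; exact hb), hβ]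
  rw [offDiag_repPoint] at hα
  have : (⟨x', z, hz⟩ : W) ∈ f.left ⁻¹ᵁ repAt α := by
    rw [hα]
    trivial
  exact this

/-- The affine scheme `Ch_2(Γ)_{u/𝔽₂, α}` over `𝔽₂`. -/
def chOver (α : Γ) : Over baseScheme.{u} :=
  Over.mk (Y := chAffine α) (Spec.map (CommRingCat.ofHom (ChRing.base α)))

/-- The open immersion of `Ch_2(Γ)_{u/𝔽₂, α}` in `Ch_2(Γ)_{u/𝔽₂}` over `𝔽₂`. -/
def chOverι (α : Γ) : chOver α ⟶ ch Γ := Over.homMk (chι α) (baseScheme_hom_ext _ _)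

theorem offDiag_companion {X : Scheme.{u}} (d : Γ(X, ⊤)) : offDiag (companion d) = ⊤ := by
  simp [offDiag, companion, Scheme.basicOpen_of_isUnit _ isUnit_one]

/-- The universal `(a, b)`-coefficients, over the global sections of `Ch_2(Γ)_{u/𝔽₂, α}`. -/
def univCoeff (α : Γ) : ABCoeff Γ Γ((chOver α).left, ⊤) α := coeffOf (𝟙 (chAffine α))

/-- The section of `π` over `Ch_2(Γ)_{u/𝔽₂, α}` given by `γ ↦ a(γ) + b(γ) C`, where `C` is the
companion matrix of `t² - d(α)`. -/
def companionSection (α : Γ) : chOver α ⟶ rep Γ :=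
  ofRep ((univCoeff α).companionRep (F2.two_eq_zero (baseOfOver (chOver α))))
    (top_unique (le_iSup_of_le α (by
      rw [ABCoeff.companionRep_self, offDiag_companion])))

theorem companionSection_quotientMap (α : Γ) :
    companionSection α ≫ quotientMap Γ = chOverι α := by
  apply Over.OverMorphism.ext
  have h2 := F2.two_eq_zero (baseOfOver (chOver α))
  have e : repPoint (companionSection α) = (univCoeff α).companionRep h2 := repPoint_ofRep _ _
  have := quotientMap_eq_of_coeff (companionSection α) (α := α)
    (by rw [e, ABCoeff.companionRep_self, offDiag_companion]) (𝟙 (chAffine α)) (by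
      rw [e, ABCoeff.companionRep_self]
      exact fun γ => rfl)
  exact this.trans (Category.id_comp _)

/-- Where an off-diagonal entry of `ρ(α)` is invertible, the action moves `ρ` to the slice. -/
theorem exists_slice {T : Over baseScheme.{u}} (f : T ⟶ rep Γ) {α : Γ}
    (hu : IsUnit ((repPoint f).rep α 0 1) ∨ IsUnit ((repPoint f).rep α 1 0)) :
    ∃ (w : T ⟶ chOver α) (h : T ⟶ pgl), w ≫ chOverι α = f ≫ quotientMap Γ ∧
      lift f h ≫ repActHom Γ = w ≫ companionSection α := by
  have h2 : (2 : Γ(T.left, ⊤)) = 0 := F2.two_eq_zero (baseOfOver T)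
  have hα : offDiag ((repPoint f).rep α) = ⊤ := by
    rcases hu with h | h <;> simp [offDiag, Scheme.basicOpen_of_isUnit _ h]
  obtain ⟨g, hg⟩ := exists_coeffHom f hα
  obtain ⟨t, ht⟩ := TraceZeroRep.exists_act_eq_companionRep h2 hg hu
  let w : T ⟶ chOver α := Over.homMk g (baseScheme_hom_ext _ _)
  refine ⟨w, pglPoint.symm t, ?_, repPoint_injective ?_⟩
  · apply Over.OverMorphism.ext
    exact (quotientMap_eq_of_coeff f hα g hg).symm
  · rw [repPoint_repActHom, lift_fst, lift_snd, Equiv.apply_symm_apply, ht, repPoint_comp,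
      companionSection, repPoint_ofRep, ABCoeff.companionRep_map _ h2]
    exact congrArg (ABCoeff.companionRep h2)
      ((congrArg coeffOf (Category.comp_id g)).symm.trans (coeffOf_comp g (𝟙 (chAffine α))))

variable (Γ) in
theorem quotientMap_hasLocalSlices : HasLocalSlices (repAction Γ).act (quotientMap Γ) := by
  intro y
  obtain ⟨α, y', hy⟩ : ∃ (α : Γ) (y' : chAffine α), chι α y' = y :=
    (chGlue Γ).ι_jointly_surjective y
  refine ⟨chOver α, chOverι α, companionSection α,
    inferInstanceAs (IsOpenImmersion (chι α)), ⟨y', hy⟩, companionSection_quotientMap α,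
    fun x hx => ?_⟩
  have hxα : x ∈ repAt α := mem_repAt_of_quotientMap hx
  let M := (repPoint (𝟙 (rep Γ))).rep α
  have hM : x ∈ offDiag M := by
    rw [offDiag_repPoint]
    exact hxα
  have key (i j : Fin 2) (hij : x ∈ (rep Γ).left.basicOpen (M i j))
      (h : (i, j) = (0, 1) ∨ (i, j) = (1, 0)) :
      ∃ (W : Over baseScheme) (k : W ⟶ rep Γ) (w : W ⟶ chOver α) (h : W ⟶ pgl),
        IsOpenImmersion k.left ∧ x ∈ Set.range k.left ∧ w ≫ chOverι α = k ≫ quotientMap Γ ∧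
        lift k h ≫ repActHom Γ = w ≫ companionSection α := by
    let U := (rep Γ).left.basicOpen (M i j)
    have hu : IsUnit ((repPoint (overOpenι (rep Γ) U)).rep α i j) := by
      apply isUnit_of_basicOpen_eq_top
      rw [← Category.comp_id (overOpenι (rep Γ) U), repPoint_comp, TraceZeroRep.map_rep]
      change (overOpen (rep Γ) U).left.basicOpen (U.ι.appTop (M i j)) = ⊤
      rw [← Scheme.preimage_basicOpen_top]
      exact U.ι_preimage_self
    obtain ⟨w, h, e₁, e₂⟩ := exists_slice (overOpenι (rep Γ) U) (α := α) (by
      rcases h with h | h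
      · obtain ⟨rfl, rfl⟩ := Prod.ext_iff.1 h
        exact Or.inl hu
      · obtain ⟨rfl, rfl⟩ := Prod.ext_iff.1 h
        exact Or.inr hu)
    exact ⟨_, _, w, h, inferInstanceAs (IsOpenImmersion U.ι), ⟨⟨x, hij⟩, rfl⟩, e₁, e₂⟩
  rcases hM with h | h
  · exact key 0 1 h (Or.inl rfl)
  · exact key 1 0 h (Or.inr rfl)

end Slices

end UnipotentMold
end

/-- For every monoid `Γ` (in particular for every group), the glued morphism
`π : Rep_2(Γ)_{u/𝔽₂} ⟶ Ch_2(Γ)_{u/𝔽₂}` is a universal geometric quotient by `PGL₂ ⊗ 𝔽₂`, acting by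
`ρ ↦ P⁻¹ ρ P`. -/
theorem mainTheorem7 (Γ : Type u) [Monoid Γ] :
    UnipotentMold.IsUniversalGeometricQuotient
      (UnipotentMold.repAction Γ).act (UnipotentMold.quotientMap Γ) :=
  (UnipotentMold.quotientMap_hasLocalSlices Γ).isUniversalGeometricQuotient
    (UnipotentMold.quotientMap_invariant Γ)
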